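/- Let $I=[0,1]$ and let $\tau:I\to I$ be piecewise monotonic: there are points $0=a_0<a_1<\dots<a_n=1$ such that $\tau$ is continuous and strictly monotonic on each $(a_{i-1},a_i)$. Fix such a set $C=\{a_0,\dots,a_n\}$ (it need not be the smallest possible one), and let $\tau_i$ be the continuous extension of $\tau|_{(a_{i-1},a_i)}$ to $[a_{i-1},a_i]$. For $x\in I$ let $\widehat\tau(x)$ be the set of one-sided limits of $\tau$ at $x$; for $T\subset I$ put $\widehat\tau(T)=\bigcup_{x\in T}\widehat\tau(x)$ and $\widehat\tau^{-1}(T)=\{x:\widehat\tau(x)\cap T\neq\emptyset\}$. Let $I_1$ be the smallest subset of $I$ that contains $C$ and is closed under $\widehat\tau$ and $\widehat\tau^{-1}$. Let $X$ be the ordered set obtained from $I$ by replacing each $x\in I_1\setminus\{0,1\}$ by two points $x^-<x^+$, with the order topology, and let $\pi:X\to I$ be the collapse map; for other $x$ write $x^-=x^+$ for the single point of $\pi^{-1}(x)$. For $c<d$ in $I_1$ put $I(c,d)=[c^+,d^-]_X$, a clopen set. Let $\sigma:X\to X$ be the local homeomorphism associated with $\tau$, i.e. the unique continuous map with $\pi\circ\sigma=\tau\circ\pi$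 on $\pi^{-1}(I\setminus I_1)$; if $y\in I(a_{i-1},a_i)$ and $y=x^{\pm}$ (where $0$ is read as $0^+$ and $1$ as $1^-$), then $\sigma(y)=\tau_i(x)^{\pm}$ if $\tau_i$ is increasing and $\sigma(y)=\tau_i(x)^{\mp}$ if $\tau_i$ is decreasing. The transfer map $\mathcal L:C(X,\mathbb Z)\to C(X,\mathbb Z)$ is $(\mathcal Lf)(x)=\sum_{\sigma(y)=x}f(y)$. The group $DG(\tau)$ (formed with $C$) is the set of classes $[f]$ of functions $f\in C(X,\mathbb Z)$ under $f\sim g\iff \mathcal L^nf=\mathcal L^ng$ for some $n\ge0$, with $[f]+[g]=[f+g]$, $DG(\tau)^+=\{[f]:f\ge0\}$ and $\mathcal L_*[f]=[\mathcal Lf]$. Assume $\tau$ is Markov with Markov partition $0=b_0<b_1<\dots<b_q=1$: all $b_i\in I_1$, $\tau$ is monotonic on each $(b_{i-1},b_i)$, each $\overline{\tau(b_{i-1},b_i)}$ is a union of intervals of the form $[b_{j-1},b_j]$, and $\widehat\tau^k(C)\subset\{b_0,\dots,b_q\}$ for some $k\ge0$. Put $E_i=I(b_{i-1},b_i)$ for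 $1\le i\le q$, let $A$ be the $q\times q$ incidence matrix, $A_{ij}=1$ if $\sigma(E_i)\supset E_j$ and $A_{ij}=0$ otherwise, and define $\psi:\mathbb Z^q\to C(X,\mathbb Z)$ by $\psi(z_1,\dots,z_q)=\sum_i z_i\chi_{E_i}$. Let $G_A$ be the inductive limit of $\mathbb Z^q\to\mathbb Z^q\to\cdots$, where every connecting map is $v\mapsto vA$; write $[v,n]$ for the class of $v$ at stage $n$, $G_A^+$ for the set of all $[v,n]$ with $v\ge0$ entrywise, and $A_*[v,n]=[vA,n]$. Then the map $\mathcal L_*$ is bijective, and $\Phi([v,n])=\mathcal L_*^{-n}[\psi(v)]$ is a well-defined isomorphism of dimension triples from $(G_A,G_A^+,A_*)$ onto $(DG(\tau),DG(\tau)^+,\mathcal L_*)$: $\Phi:G_A\to DG(\tau)$ is a group isomorphism, $\Phi(G_A^+)=DG(\tau)^+$, and $\Phi\circ A_*=\mathcal L_*\circ\Phi$. -/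

import Mathlib

open Set Filter Topology

namespace IntervalDim

/-! ### Piecewise homeomorphisms, transfer map, dimension group -/

/-- A map of a topological space to itself is a piecewise homeomorphism if it is continuous and
open, and the space has a finite partition into clopen sets each of which is mapped
homeomorphically onto its image. -/
structure IsPiecewiseHomeo {X : Type*} [TopologicalSpace X] (σ : X → X) : Prop where
  continuous : Continuous σ
  isOpenMap : IsOpenMap σ
  exists_partition : ∃ (n : ℕ) (Y : Fin n → Set X), (∀ i, IsClopen (Y i)) ∧
    Pairwise (Function.onFun Disjoint Y) ∧ (⋃ i, Y i) = univ ∧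
    ∀ i, IsEmbedding ((Y i).domRestrict σ)

/-- The transfer map on functions: `(𝓛 f)(x)` is the sum of `f y` over all `y` with `σ y = x`.
(The fibres of a piecewise homeomorphism are finite.) -/
noncomputable def transferFun {X : Type*} (σ : X → X) (f : X → ℤ) (x : X) : ℤ :=
  ∑ᶠ (y : X) (_ : y ∈ σ ⁻¹' {x}), f y

theorem IsPiecewiseHomeo.finite_fiber {X : Type*} [TopologicalSpace X] {σ : X → X}
    (hσ : IsPiecewiseHomeo σ) (x : X) : (σ ⁻¹' {x}).Finite := by
  obtain ⟨n, Y, -, -, hU, hE⟩ := hσ.exists_partition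
  have : σ ⁻¹' {x} = ⋃ i, (σ ⁻¹' {x} ∩ Y i) := by
    rw [← inter_iUnion, hU, inter_univ]
  rw [this]
  refine finite_iUnion fun i => Set.Subsingleton.finite ?_
  rintro y ⟨hy, hyi⟩ z ⟨hz, hzi⟩
  have := (hE i).injective (a₁ := ⟨y, hyi⟩) (a₂ := ⟨z, hzi⟩)
    (by rw [domRestrict_apply, domRestrict_apply]; rw [show σ y = x from hy, show σ z = x from hz])
  exact congrArg Subtype.val this

theorem IsPiecewiseHomeo.continuous_transferFun {X : Type*} [TopologicalSpace X] [CompactSpace X]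
    [T2Space X] {σ : X → X} (hσ : IsPiecewiseHomeo σ) (f : C(X, ℤ)) :
    Continuous (transferFun σ f) := by
  classical
  obtain ⟨n, Y, hY, hD, hU, hE⟩ := hσ.exists_partition
  have hinj : ∀ i y z, y ∈ Y i → z ∈ Y i → σ y = σ z → y = z := by
    intro i y z hy hz h
    exact congrArg Subtype.val ((hE i).injective (a₁ := ⟨y, hy⟩) (a₂ := ⟨z, hz⟩) h)
  have key : transferFun σ f = fun x => ∑ i, ∑ᶠ (y : X) (_ : y ∈ σ ⁻¹' {x} ∩ Y i), f y := by
    funext x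
    have h1 : σ ⁻¹' {x} = ⋃ i, (σ ⁻¹' {x} ∩ Y i) := by rw [← inter_iUnion, hU, inter_univ]
    unfold transferFun
    conv_lhs => rw [h1]
    rw [finsum_mem_iUnion, finsum_eq_sum_of_fintype]
    · intro i j hij
      exact (hD hij).mono inter_subset_right inter_subset_right
    · exact fun i => (hσ.finite_fiber x).subset inter_subset_left
  rw [key]
  refine continuous_finsetSum _ fun i _ => ?_
  have hin : ∀ y ∈ Y i, (∑ᶠ (z : X) (_ : z ∈ σ ⁻¹' {σ y} ∩ Y i), f z) = f y := by
    intro y hy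
    have : σ ⁻¹' {σ y} ∩ Y i = {y} := by
      ext z
      constructor
      · rintro ⟨hz, hzi⟩
        exact hinj i z y hzi hy hz
      · rintro rfl
        exact ⟨rfl, hy⟩
    rw [this, finsum_mem_singleton]
  have hout : ∀ x, x ∉ σ '' Y i → (∑ᶠ (z : X) (_ : z ∈ σ ⁻¹' {x} ∩ Y i), f z) = 0 := by
    intro x hx
    have : σ ⁻¹' {x} ∩ Y i = ∅ := by
      ext z
      simp only [mem_inter_iff, mem_preimage, mem_singleton_iff, mem_empty_iff_false, iff_false]
      rintro ⟨hz, hzi⟩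
      exact hx ⟨z, hzi, hz⟩
    rw [this, finsum_mem_empty]
  have hcl : IsClosed (σ '' Y i) := ((hY i).1.isCompact.image hσ.continuous).isClosed
  rw [continuous_def]
  intro T _
  by_cases h0 : (0 : ℤ) ∈ T
  · convert (hσ.isOpenMap _ ((hY i).2.inter (f.continuous.isOpen_preimage T
      (isOpen_discrete T)))).union hcl.isOpen_compl using 1
    ext x
    by_cases hx : x ∈ σ '' Y i
    · obtain ⟨y, hy, rfl⟩ := hx
      simp only [mem_preimage, hin y hy, mem_union, mem_compl_iff, mem_image_of_mem σ hy,
        not_true_eq_false, or_false]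
      constructor
      · exact fun h => ⟨y, ⟨hy, h⟩, rfl⟩
      · rintro ⟨z, ⟨hz, hzT⟩, hzy⟩
        rwa [← hinj i z y hz hy hzy]
    · rw [mem_preimage, hout x hx]
      exact ⟨fun _ => Or.inr hx, fun _ => h0⟩
  · convert hσ.isOpenMap _ ((hY i).2.inter (f.continuous.isOpen_preimage T
      (isOpen_discrete T))) using 1
    ext x
    by_cases hx : x ∈ σ '' Y i
    · obtain ⟨y, hy, rfl⟩ := hx
      simp only [mem_preimage, hin y hy]
      constructor
      · exact fun h => ⟨y, ⟨hy, h⟩, rfl⟩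
      · rintro ⟨z, ⟨hz, hzT⟩, hzy⟩
        rwa [← hinj i z y hz hy hzy]
    · simp only [mem_preimage, hout x hx, h0, false_iff]
      rintro ⟨z, ⟨hz, -⟩, hzy⟩
      exact hx ⟨z, hz, hzy⟩

section DimensionGroup

variable {X : Type*} [TopologicalSpace X] [CompactSpace X] [T2Space X] {σ : X → X}

/-- The transfer map `𝓛 = 𝓛_σ` as an additive endomorphism of `C(X, ℤ)`. -/
noncomputable def transfer (hσ : IsPiecewiseHomeo σ) : C(X, ℤ) →+ C(X, ℤ) where
  toFun f := ⟨transferFun σ f, hσ.continuous_transferFun f⟩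
  map_zero' := by
    ext x
    simp [transferFun]
  map_add' f g := by
    ext x
    exact finsum_mem_add_distrib (hσ.finite_fiber x)

/-- The congruence `f ∼ g` iff `𝓛ⁿ f = 𝓛ⁿ g` for some `n ≥ 0`. -/
noncomputable def transferCon (hσ : IsPiecewiseHomeo σ) : AddCon C(X, ℤ) where
  r f g := ∃ n : ℕ, (transfer hσ)^[n] f = (transfer hσ)^[n] g
  iseqv := by
    refine ⟨fun f => ⟨0, rfl⟩, fun ⟨n, h⟩ => ⟨n, h.symm⟩, ?_⟩
    rintro f g h ⟨n, h1⟩ ⟨m, h2⟩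
    refine ⟨n + m, ?_⟩
    rw [Nat.add_comm n m, Function.iterate_add_apply, h1, ← Function.iterate_add_apply,
      Nat.add_comm m n, Function.iterate_add_apply, h2, ← Function.iterate_add_apply]
  add' := by
    rintro f f' g g' ⟨n, h1⟩ ⟨m, h2⟩
    refine ⟨n + m, ?_⟩
    have e1 : (transfer hσ)^[n + m] f = (transfer hσ)^[n + m] f' := by
      rw [Nat.add_comm n m, Function.iterate_add_apply, h1, ← Function.iterate_add_apply]
    have e2 : (transfer hσ)^[n + m] g = (transfer hσ)^[n + m] g' := by
      rw [Function.iterate_add_apply, h2, ← Function.iterate_add_apply]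
    rw [iterate_map_add, iterate_map_add, e1, e2]

/-- The group `G_σ`: classes of functions in `C(X, ℤ)` modulo the congruence above. -/
def DimGroup (hσ : IsPiecewiseHomeo σ) : Type _ := (transferCon hσ).Quotient

noncomputable instance (hσ : IsPiecewiseHomeo σ) : AddCommGroup (DimGroup hσ) :=
  inferInstanceAs (AddCommGroup (transferCon hσ).Quotient)

/-- The class `[f]` of `f` in `G_σ`. -/
noncomputable def DimGroup.mk (hσ : IsPiecewiseHomeo σ) : C(X, ℤ) →+ DimGroup hσ :=
  (transferCon hσ).mk'

/-- The positive cone `G_σ⁺ = {[f] | f ≥ 0}`. -/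
def DimGroup.pos (hσ : IsPiecewiseHomeo σ) : Set (DimGroup hσ) :=
  {g | ∃ f : C(X, ℤ), 0 ≤ f ∧ DimGroup.mk hσ f = g}

/-- The endomorphism `𝓛_*` of `G_σ`, `𝓛_* [f] = [𝓛 f]`. -/
noncomputable def DimGroup.endo (hσ : IsPiecewiseHomeo σ) : DimGroup hσ →+ DimGroup hσ :=
  (transferCon hσ).lift ((transferCon hσ).mk'.comp (transfer hσ)) (by
    rintro f g ⟨n, h⟩
    refine (AddCon.eq (transferCon hσ)).2 ⟨n, ?_⟩
    rw [← Function.iterate_succ_apply, ← Function.iterate_succ_apply,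
      Function.iterate_succ_apply', Function.iterate_succ_apply', h])

theorem DimGroup.endo_mk (hσ : IsPiecewiseHomeo σ) (f : C(X, ℤ)) :
    DimGroup.endo hσ (DimGroup.mk hσ f) = DimGroup.mk hσ (transfer hσ f) := rfl

end DimensionGroup

/-- An isomorphism between `(G, G⁺, S)` and `(H, H⁺, T)`: a group isomorphism which maps the
positive cone onto the positive cone and intertwines the endomorphisms. -/
structure IsTripleIso {G H : Type*} [AddCommGroup G] [AddCommGroup H]
    (Gpos : Set G) (S : G →+ G) (Hpos : Set H) (T : H →+ H) (Φ : G ≃+ H) : Prop where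
  image_pos : Φ '' Gpos = Hpos
  intertwines : ∀ g, Φ (S g) = T (Φ g)

/-! ### The dimension triple of a square matrix -/

section MatrixGroup

variable {q : ℕ}

/-- `G_A`: the inductive limit of `ℤ^q → ℤ^q → ⋯`, where every connecting map is `v ↦ v A`
(so the map from stage `i` to stage `j` is `v ↦ v A^(j-i)`). -/
abbrev MatrixGroup (A : Matrix (Fin q) (Fin q) ℤ) : Type :=
  Module.DirectLimit (R := ℤ) (fun _ : ℕ => Fin q → ℤ)
    (fun i j _ => (A ^ (j - i)).vecMulLinear)

/-- The element `[v, n]` of `G_A`, represented by `v` at stage `n`. Stages are numbered from `0`; the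
limit is the same if one starts with stage `1`. -/
noncomputable def MatrixGroup.mk (A : Matrix (Fin q) (Fin q) ℤ) (v : Fin q → ℤ) (n : ℕ) :
    MatrixGroup A :=
  Module.DirectLimit.of ℤ ℕ (fun _ : ℕ => Fin q → ℤ)
    (fun i j _ => (A ^ (j - i)).vecMulLinear) n v

/-- The positive cone `G_A⁺`: elements represented at some stage by a vector with nonnegative
entries. -/
def MatrixGroup.pos (A : Matrix (Fin q) (Fin q) ℤ) : Set (MatrixGroup A) :=
  {g | ∃ (v : Fin q → ℤ) (n : ℕ), 0 ≤ v ∧ MatrixGroup.mk A v n = g}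

theorem MatrixGroup.endo_compat (A : Matrix (Fin q) (Fin q) ℤ) (i j : ℕ) (_ : i ≤ j) :
    A.vecMulLinear ∘ₗ (A ^ (j - i)).vecMulLinear =
      (A ^ (j - i)).vecMulLinear ∘ₗ A.vecMulLinear := by
  ext v k
  simp only [LinearMap.comp_apply, Matrix.vecMulLinear_apply, Matrix.vecMul_vecMul,
    ((Commute.refl A).pow_left (j - i)).eq]

/-- The canonical endomorphism `A_*` of `G_A`, `A_* [v, n] = [v A, n]`. -/
noncomputable def MatrixGroup.endo (A : Matrix (Fin q) (Fin q) ℤ) :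
    MatrixGroup A →+ MatrixGroup A :=
  (Module.DirectLimit.map (f := fun i j _ => (A ^ (j - i)).vecMulLinear)
    (f' := fun i j _ => (A ^ (j - i)).vecMulLinear) (fun _ : ℕ => A.vecMulLinear)
    (MatrixGroup.endo_compat A)).toAddMonoidHom

theorem MatrixGroup.endo_mk (A : Matrix (Fin q) (Fin q) ℤ) (v : Fin q → ℤ) (n : ℕ) :
    MatrixGroup.endo A (MatrixGroup.mk A v n) = MatrixGroup.mk A (Matrix.vecMul v A) n :=
  Module.DirectLimit.map_apply_of (f := fun i j _ => (A ^ (j - i)).vecMulLinear)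
    (f' := fun i j _ => (A ^ (j - i)).vecMulLinear) (fun _ : ℕ => A.vecMulLinear)
    (MatrixGroup.endo_compat A) v

end MatrixGroup

/-! ### Disconnecting the unit interval -/

/-- The disconnection of `[0,1]` at the points of `S`: a copy of `[0,1]` in which every point `x`
of `S` other than `0` and `1` is replaced by two points `x⁻ < x⁺`. A pair `(x, false)` stands for
`x⁻` and a pair `(x, true)` for `x⁺`; the points `0` and `1` are represented once, by
`0 = (0, true)` and `1 = (1, false)`, and a point `x ∉ S` other than `0` once, by `(x, false)`. -/
@[ext]
structure Disconnection (S : Set unitInterval) where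
  /-- the collapse map `π` -/
  π : unitInterval
  /-- `true` for the points `x⁺`, `false` for the points `x⁻` -/
  side : Bool
  left_valid : side = false → π ≠ 0
  right_valid : side = true → π = 0 ∨ (π ∈ S ∧ π ≠ 1)

namespace Disconnection

variable {S : Set unitInterval}

/-- The order of the disconnection: lexicographic, with `x⁻ < x⁺`. -/
noncomputable instance : LinearOrder (Disconnection S) :=
  LinearOrder.lift' (fun p => toLex (p.π, p.side)) (by
    intro p p' h
    have h' : (p.π, p.side) = (p'.π, p'.side) := toLex.injective h
    exact Disconnection.ext (congrArg Prod.fst h') (congrArg Prod.snd h'))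

noncomputable instance : TopologicalSpace (Disconnection S) := Preorder.topology _

instance : OrderTopology (Disconnection S) := ⟨rfl⟩

theorem le_iff {p p' : Disconnection S} :
    p ≤ p' ↔ p.π < p'.π ∨ (p.π = p'.π ∧ p.side ≤ p'.side) :=
  Prod.Lex.toLex_le_toLex

theorem lt_iff {p p' : Disconnection S} :
    p < p' ↔ p.π < p'.π ∨ (p.π = p'.π ∧ p.side < p'.side) :=
  Prod.Lex.toLex_lt_toLex

open Classical in
/-- The largest point `x⁺` of the fibre of `π` over `x`. -/
noncomputable def plus (S : Set unitInterval) (x : unitInterval) : Disconnection S :=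
  if h : x = 0 ∨ (x ∈ S ∧ x ≠ 1) then ⟨x, true, by simp, fun _ => h⟩
  else ⟨x, false, fun _ h0 => h (Or.inl h0), by simp⟩

open Classical in
/-- The smallest point `x⁻` of the fibre of `π` over `x`. -/
noncomputable def minus (S : Set unitInterval) (x : unitInterval) : Disconnection S :=
  if h : x = 0 then ⟨x, true, by simp, fun _ => Or.inl h⟩
  else ⟨x, false, fun _ => h, by simp⟩

@[simp] theorem plus_π (x : unitInterval) : (plus S x).π = x := by
  unfold plus; split_ifs <;> rfl

@[simp] theorem minus_π (x : unitInterval) : (minus S x).π = x := by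
  unfold minus; split_ifs <;> rfl

theorem plus_side {x : unitInterval} (h : x = 0 ∨ (x ∈ S ∧ x ≠ 1)) :
    (plus S x).side = true := by
  unfold plus; rw [dif_pos h]

theorem minus_side {x : unitInterval} (h : x ≠ 0) : (minus S x).side = false := by
  unfold minus; rw [dif_neg h]

theorem eq_plus {p : Disconnection S} (h : p.side = true) : p = plus S p.π :=
  Disconnection.ext (plus_π _).symm (by rw [plus_side (p.right_valid h), h])

theorem eq_minus {p : Disconnection S} (h : p.side = false) : p = minus S p.π :=
  Disconnection.ext (minus_π _).symm (by rw [minus_side (p.left_valid h), h])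

theorem le_plus (p : Disconnection S) : p ≤ plus S p.π := by
  rw [le_iff]
  refine Or.inr ⟨(plus_π _).symm, ?_⟩
  cases h : p.side
  · exact Bool.false_le _
  · rw [plus_side (p.right_valid h)]

theorem minus_le (p : Disconnection S) : minus S p.π ≤ p := by
  rw [le_iff]
  refine Or.inr ⟨minus_π _, ?_⟩
  cases h : p.side
  · rw [minus_side (p.left_valid h)]
  · exact Bool.le_true _

theorem π_mono {p p' : Disconnection S} (h : p ≤ p') : p.π ≤ p'.π := by
  rcases le_iff.1 h with h | h
  · exact h.le
  · exact h.1.le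

theorem plus_le_iff {x : unitInterval} (hx : x = 0 ∨ (x ∈ S ∧ x ≠ 1)) {p : Disconnection S} :
    plus S x ≤ p ↔ x < p.π ∨ (x = p.π ∧ p.side = true) := by
  rw [le_iff, plus_π, plus_side hx]
  cases p.side <;> simp

theorem le_minus_iff {x : unitInterval} (hx : x ≠ 0) {p : Disconnection S} :
    p ≤ minus S x ↔ p.π < x ∨ (p.π = x ∧ p.side = false) := by
  rw [le_iff, minus_π, minus_side hx]
  cases p.side <;> simp

/-- The order interval `I(x, y) = [x⁺, y⁻]`. -/
noncomputable def interval (S : Set unitInterval) (x y : unitInterval) : Set (Disconnection S) :=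
  Icc (plus S x) (minus S y)

theorem mem_interval {x y : unitInterval} (hx : x ∈ S) (hxy : x < y) {p : Disconnection S} :
    p ∈ interval S x y ↔
      (x < p.π ∨ (x = p.π ∧ p.side = true)) ∧ (p.π < y ∨ (p.π = y ∧ p.side = false)) := by
  have hx1 : x ≠ 1 := (hxy.trans_le unitInterval.le_one').ne
  have hy0 : y ≠ 0 := (unitInterval.nonneg'.trans_lt hxy).ne'
  rw [interval, mem_Icc, plus_le_iff (Or.inr ⟨hx, hx1⟩), le_minus_iff hy0]

theorem isClopen_interval {x y : unitInterval} (hx : x ∈ S) (hy : y ∈ S) (hxy : x < y) :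
    IsClopen (interval S x y) := by
  refine ⟨isClosed_Icc, ?_⟩
  have hx1 : x ≠ 1 := (hxy.trans_le unitInterval.le_one').ne
  have hy0 : y ≠ 0 := (unitInterval.nonneg'.trans_lt hxy).ne'
  have h1 : IsOpen (Ici (plus S x)) := by
    by_cases hx0 : x = 0
    · have : Ici (plus S x) = univ := by
        ext p
        simp only [mem_Ici, mem_univ, iff_true, plus_le_iff (Or.inl hx0)]
        rcases eq_or_lt_of_le (unitInterval.nonneg' : 0 ≤ p.π) with h | h
        · right
          refine ⟨hx0.trans h, ?_⟩
          by_contra hs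
          exact p.left_valid (by simpa using hs) h.symm
        · left
          rwa [hx0]
      rw [this]
      exact isOpen_univ
    · have : Ici (plus S x) = Ioi (minus S x) := by
        ext p
        rw [mem_Ici, mem_Ioi, plus_le_iff (Or.inr ⟨hx, hx1⟩), ← not_le (a := p), le_minus_iff hx0]
        rcases lt_trichotomy x p.π with h | h | h
        · simp [h, h.ne', h.le]
        · simp [h]
        · simp [h, h.ne', h.le]
      rw [this]
      exact isOpen_Ioi
  have h2 : IsOpen (Iic (minus S y)) := by
    by_cases hy1 : y = 1
    · have : Iic (minus S y) = univ := by
        ext p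
        simp only [mem_Iic, mem_univ, iff_true, le_minus_iff hy0]
        rcases eq_or_lt_of_le (unitInterval.le_one' : p.π ≤ 1) with h | h
        · right
          refine ⟨h.trans hy1.symm, ?_⟩
          by_contra hs
          rcases p.right_valid (by simpa using hs) with h0 | h0
          · exact zero_ne_one (h0.symm.trans h)
          · exact h0.2 h
        · left
          rwa [hy1]
      rw [this]
      exact isOpen_univ
    · have : Iic (minus S y) = Iio (plus S y) := by
        ext p
        rw [mem_Iic, mem_Iio, ← not_le (b := p), plus_le_iff (Or.inr ⟨hy, hy1⟩), le_minus_iff hy0]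
        rcases lt_trichotomy y p.π with h | h | h
        · simp [h, h.ne', h.le]
        · simp [h]
        · simp [h, h.ne', h.le]
      rw [this]
      exact isOpen_Iio
  exact h1.inter h2

theorem exists_isLUB (T : Set (Disconnection S)) : ∃ p, IsLUB T p := by
  classical
  set s : unitInterval := sSup (π '' T) with hs
  have hle : ∀ p ∈ T, p.π ≤ s := fun p hp => le_sSup (mem_image_of_mem _ hp)
  have hlub : ∀ r : Disconnection S, r ∈ upperBounds T → s ≤ r.π := by
    intro r hr
    refine sSup_le ?_
    rintro _ ⟨p, hp, rfl⟩
    exact π_mono (hr hp)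
  by_cases h : plus S s ∈ T
  · refine ⟨plus S s, ?_, fun r hr => hr h⟩
    intro p hp
    rcases (hle p hp).lt_or_eq with h' | h'
    · exact le_iff.2 (Or.inl (by rwa [plus_π]))
    · rw [← h']
      exact le_plus p
  · refine ⟨minus S s, ?_, fun r hr => ?_⟩
    · intro p hp
      rcases (hle p hp).lt_or_eq with h' | h'
      · exact le_iff.2 (Or.inl (by rwa [minus_π]))
      · rw [← h']
        cases hp' : p.side
        · exact (eq_minus hp').le
        · exfalso
          apply h
          rw [← h', ← eq_plus hp']
          exact hp
    · rcases (hlub r hr).lt_or_eq with h' | h'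
      · exact le_iff.2 (Or.inl (by rwa [minus_π]))
      · rw [h']
        exact minus_le r

theorem exists_isGLB (T : Set (Disconnection S)) : ∃ p, IsGLB T p := by
  obtain ⟨p, hp⟩ := exists_isLUB (lowerBounds T)
  exact ⟨p, isLUB_lowerBounds.1 hp⟩

instance : CompactSpace (Disconnection S) := by
  classical
  choose sup hsup using exists_isLUB (S := S)
  choose inf hinf using exists_isGLB (S := S)
  let _ : CompleteLattice (Disconnection S) :=
    { (inferInstance : LinearOrder (Disconnection S)),
      (inferInstance : Lattice (Disconnection S)) with
      sSup := sup
      sInf := inf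
      isLUB_sSup := hsup
      isGLB_sInf := hinf
      top := sup univ
      bot := inf univ
      le_top := fun a => (hsup univ).1 (mem_univ a)
      bot_le := fun a => (hinf univ).1 (mem_univ a) }
  let _ : CompleteLinearOrder (Disconnection S) :=
    { (inferInstance : LinearOrder (Disconnection S)), LinearOrder.toBiheytingAlgebra _,
      (inferInstance : CompleteLattice (Disconnection S)) with }
  have : OrderTopology (Disconnection S) := ⟨rfl⟩
  exact compactSpace_of_completeLinearOrder

end Disconnection

/-! ### Two facts about strictly monotone maps -/

theorem strictMonoOn_Icc_of_Ioo {α β : Type*} [LinearOrder α] [TopologicalSpace α]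
    [OrderTopology α] [DenselyOrdered α] [LinearOrder β] [TopologicalSpace β] [OrderTopology β]
    {f : α → β} {a b : α} (hc : ContinuousOn f (Icc a b)) (hm : StrictMonoOn f (Ioo a b)) :
    StrictMonoOn f (Icc a b) := by
  intro x hx y hy hxy
  obtain ⟨u, hxu, huy⟩ := exists_between hxy
  obtain ⟨v, huv, hvy⟩ := exists_between huy
  have hu : u ∈ Ioo a b := ⟨hx.1.trans_lt hxu, huy.trans_le hy.2⟩
  have hv : v ∈ Ioo a b := ⟨hu.1.trans huv, hvy.trans_le hy.2⟩
  have h1 : f x ≤ f u := by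
    have hne : (𝓝[Ioo x u] x).NeBot := left_nhdsWithin_Ioo_neBot hxu
    have ht : Tendsto f (𝓝[Ioo x u] x) (𝓝 (f x)) :=
      (hc x hx).mono_left (nhdsWithin_mono _ fun s hs =>
        ⟨hx.1.trans hs.1.le, hs.2.le.trans hu.2.le⟩)
    refine le_of_tendsto ht ?_
    filter_upwards [self_mem_nhdsWithin] with s hs
    exact (hm ⟨hx.1.trans_lt hs.1, hs.2.trans hu.2⟩ hu hs.2).le
  have h2 : f v ≤ f y := by
    have hne : (𝓝[Ioo v y] y).NeBot := right_nhdsWithin_Ioo_neBot hvy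
    have ht : Tendsto f (𝓝[Ioo v y] y) (𝓝 (f y)) :=
      (hc y hy).mono_left (nhdsWithin_mono _ fun s hs =>
        ⟨hv.1.le.trans hs.1.le, hs.2.le.trans hy.2⟩)
    refine ge_of_tendsto ht ?_
    filter_upwards [self_mem_nhdsWithin] with s hs
    exact (hm hv ⟨hv.1.trans hs.1, hs.2.trans_le hy.2⟩ hs.1).le
  exact (h1.trans_lt (hm hu hv huv)).trans_le h2

theorem strictAntiOn_Icc_of_Ioo {α β : Type*} [LinearOrder α] [TopologicalSpace α]
    [OrderTopology α] [DenselyOrdered α] [LinearOrder β] [TopologicalSpace β] [OrderTopology β]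
    {f : α → β} {a b : α} (hc : ContinuousOn f (Icc a b)) (hm : StrictAntiOn f (Ioo a b)) :
    StrictAntiOn f (Icc a b) := by
  have h := strictMonoOn_Icc_of_Ioo (β := βᵒᵈ) (f := fun x => OrderDual.toDual (f x))
    (a := a) (b := b) hc (fun x hx y hy hxy => hm hx hy hxy)
  exact fun x hx y hy hxy => h hx hy hxy

theorem isOpenEmbedding_domRestrict_of_strictMonoOn {X Y : Type*} [LinearOrder X]
    [TopologicalSpace X] [OrderTopology X] [LinearOrder Y] [TopologicalSpace Y] [OrderTopology Y]
    {f : X → Y} {s : Set X} (hs : s.OrdConnected) (hm : StrictMonoOn f s)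
    (ho : IsOpen (f '' s)) (hc : (f '' s).OrdConnected) : IsOpenEmbedding (s.domRestrict f) := by
  have h1 : OrderTopology s := orderTopology_of_ordConnected
  have h2 : OrderTopology (f '' s) := orderTopology_of_ordConnected
  exact ho.isOpenEmbedding_subtypeVal.comp (hm.orderIso f s).toHomeomorph.isOpenEmbedding

theorem isOpenEmbedding_domRestrict_of_strictAntiOn {X Y : Type*} [LinearOrder X]
    [TopologicalSpace X] [OrderTopology X] [LinearOrder Y] [TopologicalSpace Y] [OrderTopology Y]
    {f : X → Y} {s : Set X} (hs : s.OrdConnected) (hm : StrictAntiOn f s)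
    (ho : IsOpen (f '' s)) (hc : (f '' s).OrdConnected) : IsOpenEmbedding (s.domRestrict f) :=
  isOpenEmbedding_domRestrict_of_strictMonoOn (Y := Yᵒᵈ) (f := fun x => OrderDual.toDual (f x))
    hs (fun _ hx _ hy hxy => hm hx hy hxy) ho hc.dual

/-! ### Piecewise monotonic maps of the unit interval -/

/-- The multivalued map `τ̂`: the set of left and right limits of `τ` at `x` (there is no left limit
at `0` and no right limit at `1`). -/
def hat (τ : unitInterval → unitInterval) (x : unitInterval) : Set unitInterval :=
  {y | (x ≠ 0 ∧ Tendsto τ (𝓝[<] x) (𝓝 y)) ∨ (x ≠ 1 ∧ Tendsto τ (𝓝[>] x) (𝓝 y))}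

/-- `τ̂(T) = ⋃_{x ∈ T} τ̂(x)`. -/
def hatImage (τ : unitInterval → unitInterval) (T : Set unitInterval) : Set unitInterval :=
  ⋃ x ∈ T, hat τ x

/-- `τ̂⁻¹(T) = {x | τ̂(x) ∩ T ≠ ∅}`. -/
def hatPreimage (τ : unitInterval → unitInterval) (T : Set unitInterval) : Set unitInterval :=
  {x | (hat τ x ∩ T).Nonempty}

/-- A partition `0 = a₀ < a₁ < ⋯ < aₙ = 1` associated with `τ : [0,1] → [0,1]`: on every open
interval between consecutive points, `τ` is continuous and strictly monotonic. The map `τ` is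
piecewise monotonic if it has such a partition. The partition need not be the maximal one. -/
structure MonotonePartition (τ : unitInterval → unitInterval) where
  n : ℕ
  a : Fin (n + 1) → unitInterval
  strictMono : StrictMono a
  a_zero : a 0 = 0
  a_last : a (Fin.last n) = 1
  continuousOn : ∀ i : Fin n, ContinuousOn τ (Ioo (a i.castSucc) (a i.succ))
  monotonic : ∀ i : Fin n, StrictMonoOn τ (Ioo (a i.castSucc) (a i.succ)) ∨
    StrictAntiOn τ (Ioo (a i.castSucc) (a i.succ))

namespace MonotonePartition

variable {τ : unitInterval → unitInterval} (P : MonotonePartition τ)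

/-- The set `C = {a₀, …, aₙ}` of endpoints of the intervals of monotonicity. -/
def C : Set unitInterval := range P.a

/-- The generalized orbit `I₁` of `C`: the smallest set which contains `C` and is closed under
`τ̂` and `τ̂⁻¹`. -/
def I₁ : Set unitInterval :=
  ⋂₀ {T | P.C ⊆ T ∧ hatImage τ T ⊆ T ∧ hatPreimage τ T ⊆ T}

/-- The continuous extension `τ_i` of `τ` from the `i`-th open interval of monotonicity to its
closure. -/
noncomputable def branch (i : Fin P.n) : unitInterval → unitInterval :=
  extendFrom (Ioo (P.a i.castSucc) (P.a i.succ)) τ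

/-- The space `X`: the disconnection of `[0,1]` at the points of `I₁`. -/
abbrev X : Type := Disconnection P.I₁

theorem a_mem (k : Fin (P.n + 1)) : P.a k ∈ P.I₁ := by
  rintro T ⟨h, -, -⟩
  exact h ⟨k, rfl⟩

theorem mem_of_mem_hat {x y : unitInterval} (hx : x ∈ P.I₁) (hy : y ∈ hat τ x) : y ∈ P.I₁ := by
  intro T hT
  exact hT.2.1 (mem_biUnion (hx T hT) hy)

theorem mem_of_hat_mem {x y : unitInterval} (hy : y ∈ P.I₁) (hxy : y ∈ hat τ x) : x ∈ P.I₁ := by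
  intro T hT
  exact hT.2.2 ⟨y, hxy, hy T hT⟩

theorem a_lt (i : Fin P.n) : P.a i.castSucc < P.a i.succ := P.strictMono i.castSucc_lt_succ

theorem exists_tendsto (i : Fin P.n) :
    (∃ l, Tendsto τ (𝓝[>] (P.a i.castSucc)) (𝓝 l)) ∧
      ∃ l, Tendsto τ (𝓝[<] (P.a i.succ)) (𝓝 l) := by
  have hne : (Ioo (P.a i.castSucc) (P.a i.succ)).Nonempty := nonempty_Ioo.2 (P.a_lt i)
  rcases P.monotonic i with h | h
  · exact ⟨⟨_, h.monotoneOn.tendsto_nhdsWithin_Ioo_right hne (OrderBot.bddBelow _)⟩,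
      ⟨_, h.monotoneOn.tendsto_nhdsWithin_Ioo_left hne (OrderTop.bddAbove _)⟩⟩
  · exact ⟨⟨_, h.antitoneOn.tendsto_nhdsWithin_Ioo_right hne (OrderTop.bddAbove _)⟩,
      ⟨_, h.antitoneOn.tendsto_nhdsWithin_Ioo_left hne (OrderBot.bddBelow _)⟩⟩

theorem branch_continuousOn (i : Fin P.n) :
    ContinuousOn (P.branch i) (Icc (P.a i.castSucc) (P.a i.succ)) := by
  obtain ⟨⟨l, hl⟩, ⟨r, hr⟩⟩ := P.exists_tendsto i
  exact continuousOn_Icc_extendFrom_Ioo (P.continuousOn i) hl hr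

theorem branch_eq (i : Fin P.n) {x : unitInterval}
    (hx : x ∈ Ioo (P.a i.castSucc) (P.a i.succ)) : P.branch i x = τ x :=
  extendFrom_eq (subset_closure hx) (P.continuousOn i x hx)

theorem branch_mem_hat (i : Fin P.n) {x : unitInterval}
    (hx : x ∈ Icc (P.a i.castSucc) (P.a i.succ)) : P.branch i x ∈ hat τ x := by
  obtain ⟨⟨l, hl⟩, ⟨r, hr⟩⟩ := P.exists_tendsto i
  rcases eq_or_lt_of_le hx.1 with h | h
  · right
    subst h
    refine ⟨((P.a_lt i).trans_le unitInterval.le_one').ne, ?_⟩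
    rwa [branch, eq_lim_at_left_extendFrom_Ioo (P.a_lt i) hl]
  left
  refine ⟨(unitInterval.nonneg'.trans_lt h).ne', ?_⟩
  rcases eq_or_lt_of_le hx.2 with h' | h'
  · subst h'
    rwa [branch, eq_lim_at_right_extendFrom_Ioo (P.a_lt i) hr]
  · rw [P.branch_eq i ⟨h, h'⟩]
    exact ((P.continuousOn i).continuousAt (Ioo_mem_nhds h h')).mono_left nhdsWithin_le_nhds

theorem branch_mem_iff (i : Fin P.n) {x : unitInterval}
    (hx : x ∈ Icc (P.a i.castSucc) (P.a i.succ)) : P.branch i x ∈ P.I₁ ↔ x ∈ P.I₁ :=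
  ⟨fun h => P.mem_of_hat_mem h (P.branch_mem_hat i hx),
    fun h => P.mem_of_mem_hat h (P.branch_mem_hat i hx)⟩

theorem branch_strictMonoOn {i : Fin P.n}
    (h : StrictMonoOn τ (Ioo (P.a i.castSucc) (P.a i.succ))) :
    StrictMonoOn (P.branch i) (Icc (P.a i.castSucc) (P.a i.succ)) :=
  strictMonoOn_Icc_of_Ioo (P.branch_continuousOn i) (fun x hx y hy hxy => by
    rw [P.branch_eq i hx, P.branch_eq i hy]
    exact h hx hy hxy)

theorem branch_strictAntiOn {i : Fin P.n}
    (h : StrictAntiOn τ (Ioo (P.a i.castSucc) (P.a i.succ))) :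
    StrictAntiOn (P.branch i) (Icc (P.a i.castSucc) (P.a i.succ)) :=
  strictAntiOn_Icc_of_Ioo (P.branch_continuousOn i) (fun x hx y hy hxy => by
    rw [P.branch_eq i hx, P.branch_eq i hy]
    exact h hx hy hxy)

theorem not_strictMonoOn {i : Fin P.n}
    (h : StrictAntiOn τ (Ioo (P.a i.castSucc) (P.a i.succ))) :
    ¬ StrictMonoOn τ (Ioo (P.a i.castSucc) (P.a i.succ)) := by
  intro h'
  obtain ⟨u, hu, hu'⟩ := exists_between (P.a_lt i)
  obtain ⟨v, hv, hv'⟩ := exists_between hu'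
  exact lt_asymm (h ⟨hu, hu'⟩ ⟨hu.trans hv, hv'⟩ hv) (h' ⟨hu, hu'⟩ ⟨hu.trans hv, hv'⟩ hv)

/-- The clopen order interval `[a_{i-1}⁺, a_i⁻]` of `X`, one for each interval of monotonicity. -/
noncomputable def cell (i : Fin P.n) : Set P.X :=
  Disconnection.interval P.I₁ (P.a i.castSucc) (P.a i.succ)

theorem mem_cell {i : Fin P.n} {p : P.X} : p ∈ P.cell i ↔
    (P.a i.castSucc < p.π ∨ (P.a i.castSucc = p.π ∧ p.side = true)) ∧
      (p.π < P.a i.succ ∨ (p.π = P.a i.succ ∧ p.side = false)) :=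
  Disconnection.mem_interval (P.a_mem _) (P.a_lt i)

theorem isClopen_cell (i : Fin P.n) : IsClopen (P.cell i) :=
  Disconnection.isClopen_interval (P.a_mem _) (P.a_mem _) (P.a_lt i)

theorem π_mem {i : Fin P.n} {p : P.X} (hp : p ∈ P.cell i) :
    p.π ∈ Icc (P.a i.castSucc) (P.a i.succ) := by
  obtain ⟨h1, h2⟩ := P.mem_cell.1 hp
  exact ⟨h1.elim le_of_lt fun h => h.1.le, h2.elim le_of_lt fun h => h.1.le⟩

theorem exists_cell (p : P.X) : ∃ i, p ∈ P.cell i := by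
  by_contra! hcon
  simp only [P.mem_cell, not_and, not_or] at hcon
  have key : ∀ k : Fin (P.n + 1), P.a k < p.π ∨ (P.a k = p.π ∧ p.side = true) := by
    intro k
    induction k using Fin.induction with
    | zero =>
      rw [P.a_zero]
      rcases eq_or_lt_of_le (unitInterval.nonneg' : 0 ≤ p.π) with h | h
      · refine Or.inr ⟨h, ?_⟩
        by_contra hs
        exact p.left_valid (by simpa using hs) h.symm
      · exact Or.inl h
    | succ i ih =>
      obtain ⟨h1, h2⟩ := hcon i ih
      rcases eq_or_lt_of_le (not_lt.1 h1) with h | h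
      · exact Or.inr ⟨h, by simpa using h2 h.symm⟩
      · exact Or.inl h
  have := key (Fin.last P.n)
  rw [P.a_last] at this
  rcases this with h | ⟨h, hs⟩
  · exact absurd h (not_lt.2 unitInterval.le_one')
  · rcases p.right_valid hs with h0 | h0
    · exact one_ne_zero (h.trans h0)
    · exact h0.2 h.symm

theorem cell_unique {i j : Fin P.n} {p : P.X} (hi : p ∈ P.cell i) (hj : p ∈ P.cell j) :
    i = j := by
  have aux : ∀ i j : Fin P.n, p ∈ P.cell i → p ∈ P.cell j → ¬ i < j := by
    intro i j hi hj hij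
    have h1 := (P.mem_cell.1 hi).2
    have h2 := (P.mem_cell.1 hj).1
    have h3 : P.a i.succ ≤ P.a j.castSucc :=
      P.strictMono.monotone (Fin.succ_le_castSucc_iff.2 hij)
    rcases h1 with h1 | ⟨h1, hs⟩
    · rcases h2 with h2 | ⟨h2, -⟩
      · exact lt_asymm (h1.trans_le h3) h2
      · exact absurd (h1.trans_le h3) (by rw [h2]; exact lt_irrefl _)
    · rcases h2 with h2 | ⟨h2, hs'⟩
      · exact absurd (h3.trans_lt h2) (by rw [h1]; exact lt_irrefl _)
      · rw [hs] at hs'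
        exact Bool.noConfusion hs'
  exact le_antisymm (not_lt.1 (aux j i hj hi)) (not_lt.1 (aux i j hi hj))

/-- The index of the order interval `[a_{i-1}⁺, a_i⁻]` which contains `p`. -/
noncomputable def idx (p : P.X) : Fin P.n := Classical.choose (P.exists_cell p)

theorem idx_mem (p : P.X) : p ∈ P.cell (P.idx p) := Classical.choose_spec (P.exists_cell p)

open Classical in
/-- The lift of the branch `τ_i`: `x^± ↦ τ_i(x)^±` if `τ` increases on the `i`-th interval of
monotonicity, and `x^± ↦ τ_i(x)^∓` if it decreases there. -/
noncomputable def branchLift (i : Fin P.n) (p : P.X) : P.X :=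
  if StrictMonoOn τ (Ioo (P.a i.castSucc) (P.a i.succ)) ↔ p.side = true then
    Disconnection.plus P.I₁ (P.branch i p.π)
  else Disconnection.minus P.I₁ (P.branch i p.π)

/-- The local homeomorphism `σ : X → X` associated with `τ` (and the partition). It is the unique
continuous map with `π ∘ σ = τ ∘ π` off the preimage of `I₁`. -/
noncomputable def σ (p : P.X) : P.X := P.branchLift (P.idx p) p

theorem σ_eq {i : Fin P.n} {p : P.X} (hp : p ∈ P.cell i) : P.σ p = P.branchLift i p := by
  rw [σ, P.cell_unique (P.idx_mem p) hp]

theorem π_branchLift (i : Fin P.n) (p : P.X) : (P.branchLift i p).π = P.branch i p.π := by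
  unfold branchLift
  split_ifs
  · exact Disconnection.plus_π _
  · exact Disconnection.minus_π _

/-- Two points of a cell in the same fibre of `π`. -/
theorem fibre_aux {i : Fin P.n} {p p' : P.X} (hp : p ∈ P.cell i) (hp' : p' ∈ P.cell i)
    (h : p.π = p'.π) (hs : p.side = false) (hs' : p'.side = true) :
    p.π ∈ P.I₁ ∧ p.π ∈ Ioo (P.a i.castSucc) (P.a i.succ) := by
  have h1 := (P.mem_cell.1 hp).1
  have h2 := (P.mem_cell.1 hp').2
  rw [hs] at h1
  rw [hs'] at h2
  have h3 := p'.right_valid hs'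
  rw [← h] at h2 h3
  refine ⟨(h3.resolve_left (p.left_valid hs)).1, ?_, ?_⟩
  · simpa using h1
  · simpa using h2

theorem branchLift_strictMonoOn {i : Fin P.n}
    (h : StrictMonoOn τ (Ioo (P.a i.castSucc) (P.a i.succ))) :
    StrictMonoOn (P.branchLift i) (P.cell i) := by
  intro p hp p' hp' hlt
  have hm := P.branch_strictMonoOn h
  rcases Disconnection.lt_iff.1 hlt with h1 | ⟨h1, h2⟩
  · rw [Disconnection.lt_iff, P.π_branchLift, P.π_branchLift]
    exact Or.inl (hm (P.π_mem hp) (P.π_mem hp') h1)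
  · have hs : p.side = false ∧ p'.side = true := by
      revert h2; cases p.side <;> cases p'.side <;> simp
    obtain ⟨hI, hx⟩ := P.fibre_aux hp hp' h1 hs.1 hs.2
    have hxc := Ioo_subset_Icc_self hx
    have ha := left_mem_Icc.2 (P.a_lt i).le
    have hb := right_mem_Icc.2 (P.a_lt i).le
    have h0 : P.branch i p.π ≠ 0 := (unitInterval.nonneg'.trans_lt (hm ha hxc hx.1)).ne'
    have h1' : P.branch i p.π ≠ 1 := ((hm hxc hb hx.2).trans_le unitInterval.le_one').ne
    rw [Disconnection.lt_iff, P.π_branchLift, P.π_branchLift, ← h1]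
    refine Or.inr ⟨rfl, ?_⟩
    unfold branchLift
    rw [if_neg (by simp [hs.1, h]), if_pos (by simp [hs.2, h]), ← h1,
      Disconnection.minus_side h0,
      Disconnection.plus_side (Or.inr ⟨(P.branch_mem_iff i hxc).2 hI, h1'⟩)]
    decide

theorem branchLift_strictAntiOn {i : Fin P.n}
    (h : StrictAntiOn τ (Ioo (P.a i.castSucc) (P.a i.succ))) :
    StrictAntiOn (P.branchLift i) (P.cell i) := by
  intro p hp p' hp' hlt
  have hm := P.branch_strictAntiOn h
  have hn := P.not_strictMonoOn h
  rcases Disconnection.lt_iff.1 hlt with h1 | ⟨h1, h2⟩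
  · rw [Disconnection.lt_iff, P.π_branchLift, P.π_branchLift]
    exact Or.inl (hm (P.π_mem hp) (P.π_mem hp') h1)
  · have hs : p.side = false ∧ p'.side = true := by
      revert h2; cases p.side <;> cases p'.side <;> simp
    obtain ⟨hI, hx⟩ := P.fibre_aux hp hp' h1 hs.1 hs.2
    have hxc := Ioo_subset_Icc_self hx
    have ha := left_mem_Icc.2 (P.a_lt i).le
    have hb := right_mem_Icc.2 (P.a_lt i).le
    have h0 : P.branch i p.π ≠ 0 := (unitInterval.nonneg'.trans_lt (hm hxc hb hx.2)).ne'
    have h1' : P.branch i p.π ≠ 1 := ((hm ha hxc hx.1).trans_le unitInterval.le_one').ne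
    rw [Disconnection.lt_iff, P.π_branchLift, P.π_branchLift, ← h1]
    refine Or.inr ⟨rfl, ?_⟩
    unfold branchLift
    rw [if_neg (by simp [hs.2, hn]), if_pos (by simp [hs.1, hn]), ← h1,
      Disconnection.minus_side h0,
      Disconnection.plus_side (Or.inr ⟨(P.branch_mem_iff i hxc).2 hI, h1'⟩)]
    decide

theorem image_cell_of_strictMonoOn {i : Fin P.n}
    (h : StrictMonoOn τ (Ioo (P.a i.castSucc) (P.a i.succ))) :
    P.branchLift i '' P.cell i = Disconnection.interval P.I₁ (P.branch i (P.a i.castSucc))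
      (P.branch i (P.a i.succ)) := by
  have hm := P.branch_strictMonoOn h
  have ha := left_mem_Icc.2 (P.a_lt i).le
  have hb := right_mem_Icc.2 (P.a_lt i).le
  have hlt := hm ha hb (P.a_lt i)
  have haI := (P.branch_mem_iff i ha).2 (P.a_mem _)
  ext r
  rw [Disconnection.mem_interval haI hlt]
  constructor
  · rintro ⟨p, hp, rfl⟩
    have hx := P.π_mem hp
    obtain ⟨h1, h2⟩ := P.mem_cell.1 hp
    rw [P.π_branchLift]
    constructor
    · rcases h1 with h1 | ⟨h1, hs⟩
      · exact Or.inl (hm ha hx h1)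
      · right
        refine ⟨by rw [h1], ?_⟩
        unfold branchLift
        rw [if_pos (by simp [h, hs]), ← h1]
        exact Disconnection.plus_side (Or.inr ⟨haI, (hlt.trans_le unitInterval.le_one').ne⟩)
    · rcases h2 with h2 | ⟨h2, hs⟩
      · exact Or.inl (hm hx hb h2)
      · right
        refine ⟨by rw [h2], ?_⟩
        unfold branchLift
        rw [if_neg (by simp [h, hs]), h2]
        exact Disconnection.minus_side (unitInterval.nonneg'.trans_lt hlt).ne'
  · rintro ⟨h1, h2⟩
    obtain ⟨t, ht, hts⟩ := intermediate_value_Icc (P.a_lt i).le (P.branch_continuousOn i)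
      (show r.π ∈ Icc _ _ from ⟨h1.elim le_of_lt fun h => h.1.le, h2.elim le_of_lt fun h => h.1.le⟩)
    cases hs : r.side
    · have hta : P.a i.castSucc < t := by
        refine lt_of_le_of_ne ht.1 ?_
        rintro rfl
        simp [hs, hts] at h1
      refine ⟨⟨t, false, fun _ => (unitInterval.nonneg'.trans_lt hta).ne', by simp⟩, ?_, ?_⟩
      · exact P.mem_cell.2 ⟨Or.inl hta, ht.2.lt_or_eq.imp id fun h => ⟨h, rfl⟩⟩
      · unfold branchLift
        rw [if_neg (by simp [h])]
        dsimp only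
        rw [hts]
        exact (Disconnection.eq_minus hs).symm
    · have htb : t < P.a i.succ := by
        refine lt_of_le_of_ne ht.2 ?_
        rintro rfl
        simp [hs, hts] at h2
      have hval : t = 0 ∨ (t ∈ P.I₁ ∧ t ≠ 1) := by
        refine Or.inr ⟨?_, (htb.trans_le unitInterval.le_one').ne⟩
        rcases h1 with h1 | ⟨h1, -⟩
        · refine (P.branch_mem_iff i ht).1 ?_
          rw [hts]
          rcases r.right_valid hs with h0 | h0
          · rw [h0] at h1
            exact absurd h1 (not_lt.2 unitInterval.nonneg')
          · exact h0.1
        · have : P.a i.castSucc = t := hm.injOn ha ht (h1.trans hts.symm)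
          rw [← this]
          exact P.a_mem _
      refine ⟨⟨t, true, by simp, fun _ => hval⟩, ?_, ?_⟩
      · exact P.mem_cell.2 ⟨ht.1.lt_or_eq.imp id fun h => ⟨h, rfl⟩, Or.inl htb⟩
      · unfold branchLift
        rw [if_pos (by simp [h])]
        dsimp only
        rw [hts]
        exact (Disconnection.eq_plus hs).symm

theorem image_cell_of_strictAntiOn {i : Fin P.n}
    (h : StrictAntiOn τ (Ioo (P.a i.castSucc) (P.a i.succ))) :
    P.branchLift i '' P.cell i = Disconnection.interval P.I₁ (P.branch i (P.a i.succ))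
      (P.branch i (P.a i.castSucc)) := by
  have hm := P.branch_strictAntiOn h
  have hn := P.not_strictMonoOn h
  have ha := left_mem_Icc.2 (P.a_lt i).le
  have hb := right_mem_Icc.2 (P.a_lt i).le
  have hlt := hm ha hb (P.a_lt i)
  have hbI := (P.branch_mem_iff i hb).2 (P.a_mem _)
  ext r
  rw [Disconnection.mem_interval hbI hlt]
  constructor
  · rintro ⟨p, hp, rfl⟩
    have hx := P.π_mem hp
    obtain ⟨h1, h2⟩ := P.mem_cell.1 hp
    rw [P.π_branchLift]
    constructor
    · rcases h2 with h2 | ⟨h2, hs⟩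
      · exact Or.inl (hm hx hb h2)
      · right
        refine ⟨by rw [h2], ?_⟩
        unfold branchLift
        rw [if_pos (by simp [hn, hs]), h2]
        exact Disconnection.plus_side (Or.inr ⟨hbI, (hlt.trans_le unitInterval.le_one').ne⟩)
    · rcases h1 with h1 | ⟨h1, hs⟩
      · exact Or.inl (hm ha hx h1)
      · right
        refine ⟨by rw [h1], ?_⟩
        unfold branchLift
        rw [if_neg (by simp [hn, hs]), ← h1]
        exact Disconnection.minus_side (unitInterval.nonneg'.trans_lt hlt).ne'
  · rintro ⟨h1, h2⟩
    obtain ⟨t, ht, hts⟩ := intermediate_value_Icc' (P.a_lt i).le (P.branch_continuousOn i)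
      (show r.π ∈ Icc _ _ from ⟨h1.elim le_of_lt fun h => h.1.le, h2.elim le_of_lt fun h => h.1.le⟩)
    cases hs : r.side
    · have htb : t < P.a i.succ := by
        refine lt_of_le_of_ne ht.2 ?_
        rintro rfl
        simp [hs, hts] at h1
      by_cases hr : t ∈ P.I₁
      · refine ⟨⟨t, true, by simp, fun _ =>
          Or.inr ⟨hr, (htb.trans_le unitInterval.le_one').ne⟩⟩, ?_, ?_⟩
        · exact P.mem_cell.2 ⟨ht.1.lt_or_eq.imp id fun h => ⟨h, rfl⟩, Or.inl htb⟩
        · unfold branchLift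
          rw [if_neg (by simp [hn])]
          dsimp only
          rw [hts]
          exact (Disconnection.eq_minus hs).symm
      · have hta : P.a i.castSucc < t := by
          refine lt_of_le_of_ne ht.1 ?_
          rintro rfl
          exact hr (P.a_mem _)
        refine ⟨⟨t, false, fun _ => (unitInterval.nonneg'.trans_lt hta).ne', by simp⟩, ?_, ?_⟩
        · exact P.mem_cell.2 ⟨Or.inl hta, Or.inl htb⟩
        · unfold branchLift
          rw [if_pos (by simp [hn])]
          dsimp only
          rw [hts]
          refine Disconnection.ext (Disconnection.plus_π _) ?_
          unfold Disconnection.plus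
          rw [dif_neg, hs]
          rintro (h0 | h0)
          · exact r.left_valid hs h0
          · rw [← hts] at h0
            exact hr ((P.branch_mem_iff i ht).1 h0.1)
    · have hta : P.a i.castSucc < t := by
        refine lt_of_le_of_ne ht.1 ?_
        rintro rfl
        simp [hs, hts] at h2
      refine ⟨⟨t, false, fun _ => (unitInterval.nonneg'.trans_lt hta).ne', by simp⟩, ?_, ?_⟩
      · exact P.mem_cell.2 ⟨Or.inl hta, ht.2.lt_or_eq.imp id fun h => ⟨h, rfl⟩⟩
      · unfold branchLift
        rw [if_pos (by simp [hn])]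
        dsimp only
        rw [hts]
        exact (Disconnection.eq_plus hs).symm

theorem isOpenEmbedding_cell (i : Fin P.n) : IsOpenEmbedding ((P.cell i).domRestrict P.σ) := by
  have he : (P.cell i).domRestrict P.σ = (P.cell i).domRestrict (P.branchLift i) := by
    funext p
    exact P.σ_eq p.2
  rw [he]
  have ha := left_mem_Icc.2 (P.a_lt i).le
  have hb := right_mem_Icc.2 (P.a_lt i).le
  have haI := (P.branch_mem_iff i ha).2 (P.a_mem _)
  have hbI := (P.branch_mem_iff i hb).2 (P.a_mem _)
  rcases P.monotonic i with h | h
  · refine isOpenEmbedding_domRestrict_of_strictMonoOn ordConnected_Icc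
      (P.branchLift_strictMonoOn h) ?_ ?_
    · rw [P.image_cell_of_strictMonoOn h]
      exact (Disconnection.isClopen_interval haI hbI
        (P.branch_strictMonoOn h ha hb (P.a_lt i))).2
    · rw [P.image_cell_of_strictMonoOn h]
      exact ordConnected_Icc
  · refine isOpenEmbedding_domRestrict_of_strictAntiOn ordConnected_Icc
      (P.branchLift_strictAntiOn h) ?_ ?_
    · rw [P.image_cell_of_strictAntiOn h]
      exact (Disconnection.isClopen_interval hbI haI
        (P.branch_strictAntiOn h ha hb (P.a_lt i))).2
    · rw [P.image_cell_of_strictAntiOn h]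
      exact ordConnected_Icc

theorem isPiecewiseHomeo : IsPiecewiseHomeo P.σ where
  continuous := by
    rw [continuous_iff_continuousAt]
    intro p
    have h : ContinuousOn P.σ (P.cell (P.idx p)) :=
      continuousOn_iff_continuous_domRestrict.2 (P.isOpenEmbedding_cell _).continuous
    exact h.continuousAt ((P.isClopen_cell _).2.mem_nhds (P.idx_mem p))
  isOpenMap := by
    intro U hU
    have : P.σ '' U = ⋃ i, (P.cell i).domRestrict P.σ '' (Subtype.val ⁻¹' U) := by
      ext r
      simp only [mem_iUnion, mem_image, mem_preimage, Subtype.exists, domRestrict_apply]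
      constructor
      · rintro ⟨p, hp, rfl⟩
        exact ⟨P.idx p, p, P.idx_mem p, hp, rfl⟩
      · rintro ⟨i, p, _, hp, rfl⟩
        exact ⟨p, hp, rfl⟩
    rw [this]
    exact isOpen_iUnion fun i =>
      (P.isOpenEmbedding_cell i).isOpenMap _ (hU.preimage continuous_subtype_val)
  exists_partition := by
    refine ⟨P.n, P.cell, P.isClopen_cell, ?_, ?_, fun i => (P.isOpenEmbedding_cell i).isEmbedding⟩
    · intro i j hij
      exact Set.disjoint_left.2 fun p hi hj => hij (P.cell_unique hi hj)
    · exact eq_univ_of_forall fun p => mem_iUnion.2 (P.exists_cell p)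

/-- The relation `π ∘ σ = τ ∘ π` on `X₀ = π⁻¹(I₀)`, where `I₀` is the complement of `I₁`. -/
theorem π_σ {p : P.X} (hp : p.π ∉ P.I₁) : (P.σ p).π = τ p.π := by
  have hi := P.π_mem (P.idx_mem p)
  rw [σ, P.π_branchLift]
  refine P.branch_eq _ ⟨lt_of_le_of_ne hi.1 ?_, lt_of_le_of_ne hi.2 ?_⟩
  · intro h
    exact hp (h ▸ P.a_mem _)
  · intro h
    exact hp (h ▸ P.a_mem _)

/-- The dimension group `DG(τ)`, formed with the given partition: the group `G_σ` of the associated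
local homeomorphism. -/
abbrev DG : Type := DimGroup P.isPiecewiseHomeo

/-- The class `[f]` in `DG(τ)` of a function `f ∈ C(X, ℤ)`. -/
noncomputable abbrev cls (f : C(P.X, ℤ)) : P.DG := DimGroup.mk P.isPiecewiseHomeo f

/-- The positive cone `DG(τ)⁺`. -/
abbrev DGpos : Set P.DG := DimGroup.pos P.isPiecewiseHomeo

/-- The endomorphism `𝓛_*` of `DG(τ)`. -/
noncomputable abbrev Lstar : P.DG →+ P.DG := DimGroup.endo P.isPiecewiseHomeo

end MonotonePartition

/-! ### Markov partitions -/

/-- A Markov partition `0 = b₀ < b₁ < ⋯ < b_q = 1` for a piecewise monotonic map `τ` with associated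
partition `C`. -/
structure MarkovPartition {τ : unitInterval → unitInterval} (P : MonotonePartition τ) where
  q : ℕ
  b : Fin (q + 1) → unitInterval
  strictMono : StrictMono b
  b_zero : b 0 = 0
  b_last : b (Fin.last q) = 1
  b_mem : ∀ k, b k ∈ P.I₁
  monotonic : ∀ i : Fin q, MonotoneOn τ (Ioo (b i.castSucc) (b i.succ)) ∨
    AntitoneOn τ (Ioo (b i.castSucc) (b i.succ))
  closure_image : ∀ i : Fin q, ∃ J : Set (Fin q),
    closure (τ '' Ioo (b i.castSucc) (b i.succ)) = ⋃ j ∈ J, Icc (b j.castSucc) (b j.succ)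
  orbit : ∃ k : ℕ, (hatImage τ)^[k] P.C ⊆ range b

namespace MarkovPartition

variable {τ : unitInterval → unitInterval} {P : MonotonePartition τ} (B : MarkovPartition P)

/-- The member `E_i = I(b_{i-1}, b_i)` of the associated Markov partition of `X`. -/
noncomputable def E (i : Fin B.q) : Set P.X :=
  Disconnection.interval P.I₁ (B.b i.castSucc) (B.b i.succ)

theorem isClopen_E (i : Fin B.q) : IsClopen (B.E i) :=
  Disconnection.isClopen_interval (B.b_mem _) (B.b_mem _) (B.strictMono i.castSucc_lt_succ)

/-- The characteristic function of `E_i`. -/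
noncomputable def χ (i : Fin B.q) : C(P.X, ℤ) :=
  ⟨(B.E i).indicator 1, (B.isClopen_E i).continuous_indicator continuous_one⟩

open Classical in
/-- The incidence matrix: `A_{ij} = 1` if `σ(E_i) ⊇ E_j`, and `A_{ij} = 0` otherwise. -/
noncomputable def A : Matrix (Fin B.q) (Fin B.q) ℤ :=
  Matrix.of fun i j => if B.E j ⊆ P.σ '' B.E i then 1 else 0

/-- `ψ(z₁, …, z_q) = ∑ z_i χ_{E_i}`. -/
noncomputable def ψ (z : Fin B.q → ℤ) : C(P.X, ℤ) := ∑ i, z i • B.χ i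

end MarkovPartition

end IntervalDim

/-! Injectivity of `𝓛_*` is built into the congruence. The rest rests on the Markov structure that
`τ` induces on `X`: `σ` is injective on each `E_i` (`injOn_σ`), and `σ(E_i)` is a union of sets
`E_j` (`exists_image_σ_eq`). Consequently `𝓛 (ψ v) = ψ (v A)` (`transfer_ψ`), which makes `[v, n] ↦
𝓛_*⁻ⁿ [ψ v]` compatible with the connecting maps once `𝓛_*` is known to be invertible.

Surjectivity of `𝓛_*`: the sets `σⁿ(X)` decrease and are unions of members of the finite partition,
so they stabilize at some `Y = σᴺ(X)` with `Y ⊆ σ(Y)`. A function supported in `Y` is the transfer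
of another one supported in `Y`, obtained by choosing for every `E_j ⊆ Y` one `E_i ⊆ Y` that covers
it (`exists_transfer_eq`). Every `𝓛ᴺ f` is supported in `Y`. The construction keeps nonnegativity,
so `𝓛_*⁻¹` preserves the positive cone.

Surjectivity of `Φ`: a continuous integer-valued function jumps across only finitely many points of
`I₁` (`jumps_finite`). Up to the points `b_k`, the transfer map moves jumps forward by `τ̂`
(`jumps_transfer_subset`). Every point of `I₁` is eventually carried into `{b_k}` by `τ̂`
(`exists_hatImage_iterate_subset`). So some `𝓛ⁿ f` jumps only at points `b_k`, that is, `𝓛ⁿ f = ψ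
v`. Injectivity of `Φ` follows from that of `ψ`.

The delicate point is that `C` need not lie in `{b_k}`, and `τ` is only assumed weakly monotonic on
the Markov intervals. Facts about `σ` on `E_i` are therefore read off from one-sided limits of `τ`
(`tendsto_sideNhds`) and from the openness of `σ`, not from the branches `τ_i`. -/

namespace IntervalDim

/-! ### Topology of the disconnected interval: open sets, fibres of `π`, jumps. -/

namespace Disconnection

variable {S : Set unitInterval}

theorem eq_minus_or_eq_plus (p : Disconnection S) : p = minus S p.π ∨ p = plus S p.π := by
  cases h : p.side
  · exact Or.inl (eq_minus h)
  · exact Or.inr (eq_plus h)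

theorem mem_of_minus_ne_plus {x : unitInterval} (h : minus S x ≠ plus S x) : x ∈ S := by
  by_contra hx
  apply h
  unfold minus plus
  by_cases h0 : x = 0 <;> simp [h0, hx]

theorem apply_eq_of_π_eq {α : Type*} {f : Disconnection S → α} {p p' : Disconnection S}
    (h : p.π = p'.π) (hf : f (minus S p.π) = f (plus S p.π)) : f p = f p' := by
  rcases p.eq_minus_or_eq_plus with h1 | h1 <;> rcases p'.eq_minus_or_eq_plus with h2 | h2 <;>
    rw [h1, h2, ← h] <;> simp [hf]

theorem π_ne_one {p : Disconnection S} (hs : p.side = true) : p.π ≠ 1 := by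
  rcases p.right_valid hs with h | h
  · rw [h]
    exact zero_ne_one
  · exact h.2

theorem continuous_π : Continuous (π : Disconnection S → unitInterval) :=
  Monotone.continuous_of_surjective (fun _ _ h => π_mono h) fun x => ⟨minus S x, minus_π x⟩

theorem exists_gt_of_isOpen {O : Set (Disconnection S)} (hO : IsOpen O) {p : Disconnection S}
    (hp : p ∈ O) (hs : p.side = true) :
    ∃ y, p.π < y ∧ ∀ q : Disconnection S, p.π < q.π → q.π < y → q ∈ O := by
  have hlt : p < minus S 1 := lt_iff.2 (Or.inl (by
    rw [minus_π]
    exact lt_of_le_of_ne unitInterval.le_one' (π_ne_one hs)))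
  obtain ⟨u, hu, hsub⟩ := exists_Ico_subset_of_mem_nhds (hO.mem_nhds hp) ⟨_, hlt⟩
  refine ⟨u.π, ?_, fun q h1 h2 => hsub ⟨le_iff.2 (Or.inl h1), lt_iff.2 (Or.inl h2)⟩⟩
  rcases lt_iff.1 hu with h | ⟨-, h⟩
  · exact h
  · rw [hs] at h
    exact absurd h (not_lt.2 (Bool.le_true _))

theorem exists_lt_of_isOpen {O : Set (Disconnection S)} (hO : IsOpen O) {p : Disconnection S}
    (hp : p ∈ O) (hs : p.side = false) :
    ∃ y, y < p.π ∧ ∀ q : Disconnection S, y < q.π → q.π < p.π → q ∈ O := by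
  have hlt : plus S 0 < p := lt_iff.2 (Or.inl (by
    rw [plus_π]
    exact lt_of_le_of_ne unitInterval.nonneg' (p.left_valid hs).symm))
  obtain ⟨u, hu, hsub⟩ := exists_Ioc_subset_of_mem_nhds (hO.mem_nhds hp) ⟨_, hlt⟩
  refine ⟨u.π, ?_, fun q h1 h2 => hsub ⟨lt_iff.2 (Or.inl h1), le_iff.2 (Or.inl h2)⟩⟩
  rcases lt_iff.1 hu with h | ⟨-, h⟩
  · exact h
  · rw [hs] at h
    exact absurd h (not_lt.2 (Bool.false_le _))

/-- An open set which contains `p` also contains a full fibre of the collapse map, other than that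
of `p`. -/
theorem exists_π_ne_of_isOpen {O : Set (Disconnection S)} (hO : IsOpen O) {p : Disconnection S}
    (hp : p ∈ O) : ∃ x, x ≠ p.π ∧ ∀ q : Disconnection S, q.π = x → q ∈ O := by
  cases hs : p.side
  · obtain ⟨y, hy, h⟩ := exists_lt_of_isOpen hO hp hs
    obtain ⟨x, h1, h2⟩ := exists_between hy
    exact ⟨x, h2.ne, fun q hq => h q (hq ▸ h1) (hq ▸ h2)⟩
  · obtain ⟨y, hy, h⟩ := exists_gt_of_isOpen hO hp hs
    obtain ⟨x, h1, h2⟩ := exists_between hy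
    exact ⟨x, h1.ne', fun q hq => h q (hq ▸ h1) (hq ▸ h2)⟩

/-- If `F \ G` were nonempty, it would contain a whole fibre of `π`, whose base point lies in `π(F)`
but not in `π(G)`. It follows that a clopen set is determined by its projection. -/
theorem subset_of_image_π_subset {F G : Set (Disconnection S)} (hF : IsOpen F) (hG : IsClosed G)
    (h : π '' F ⊆ π '' G) : F ⊆ G := by
  intro p hp
  by_contra hpG
  obtain ⟨x, -, hx⟩ := exists_π_ne_of_isOpen (hF.inter hG.isOpen_compl) ⟨hp, hpG⟩
  obtain ⟨q, hq, hqx⟩ := h ⟨minus S x, (hx _ (minus_π x)).1, minus_π x⟩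
  exact (hx q hqx).2 hq

/-- The one-sided neighbourhoods of `π p` on the side of `p`. -/
def sideNhds (p : Disconnection S) : Filter unitInterval :=
  if p.side = true then 𝓝[>] p.π else 𝓝[<] p.π

theorem sideNhds_neBot (p : Disconnection S) : p.sideNhds.NeBot := by
  unfold sideNhds
  split_ifs with h
  · exact nhdsGT_neBot_of_exists_gt
      ⟨1, lt_of_le_of_ne unitInterval.le_one' (π_ne_one h)⟩
  · exact nhdsLT_neBot_of_exists_lt
      ⟨0, lt_of_le_of_ne unitInterval.nonneg' (p.left_valid (by simpa using h)).symm⟩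

theorem sideNhds_le (p : Disconnection S) : p.sideNhds ≤ 𝓝 p.π := by
  unfold sideNhds
  split_ifs <;> exact nhdsWithin_le_nhds

/-- Over an endpoint of `[x, y]`, the only point of the interval is the one that faces inwards. -/
theorem Ioo_mem_sideNhds {x y : unitInterval} (hx : x ∈ S) (hxy : x < y) {p : Disconnection S}
    (hp : p ∈ interval S x y) : Ioo x y ∈ p.sideNhds := by
  obtain ⟨h1, h2⟩ := (mem_interval hx hxy).1 hp
  unfold sideNhds
  split_ifs with h
  · exact mem_of_superset (Ioo_mem_nhdsGT (h2.resolve_right (by simp [h]))) fun z hz =>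
      ⟨(h1.elim le_of_lt fun h => h.1.le).trans_lt hz.1, hz.2⟩
  · exact mem_of_superset (Ioo_mem_nhdsLT (h1.resolve_right (by simp [h]))) fun z hz =>
      ⟨hz.1, hz.2.trans_le (h2.elim le_of_lt fun h => h.1.le)⟩

theorem image_π_interval {x y : unitInterval} (hx : x ∈ S) (hxy : x < y) :
    π '' interval S x y = Icc x y := by
  have hx1 : x ≠ 1 := (hxy.trans_le unitInterval.le_one').ne
  have hy0 : y ≠ 0 := (unitInterval.nonneg'.trans_lt hxy).ne'
  ext z
  constructor
  · rintro ⟨p, hp, rfl⟩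
    obtain ⟨h1, h2⟩ := (mem_interval hx hxy).1 hp
    exact ⟨h1.elim le_of_lt fun h => h.1.le, h2.elim le_of_lt fun h => h.1.le⟩
  · rintro ⟨h1, h2⟩
    rcases h1.eq_or_lt with rfl | h1
    · exact ⟨plus S x, (mem_interval hx hxy).2
        ⟨Or.inr ⟨by simp, plus_side (Or.inr ⟨hx, hx1⟩)⟩, Or.inl (by simpa)⟩, plus_π x⟩
    · refine ⟨minus S z, (mem_interval hx hxy).2 ⟨Or.inl (by simpa), ?_⟩, minus_π z⟩
      rw [minus_π]
      exact h2.lt_or_eq.imp id fun h => ⟨h, minus_side (h ▸ hy0)⟩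

theorem mem_interval_of_mem_Ioo {x y : unitInterval} (hx : x ∈ S) {p : Disconnection S}
    (hp : p.π ∈ Ioo x y) : p ∈ interval S x y :=
  (mem_interval hx (hp.1.trans hp.2)).2 ⟨Or.inl hp.1, Or.inl hp.2⟩

/-- The points at which `f` takes different values on the two sides. -/
def jumps {α : Type*} (f : Disconnection S → α) : Set unitInterval :=
  {x | f (minus S x) ≠ f (plus S x)}

theorem jumps_subset {α : Type*} (f : Disconnection S → α) : jumps f ⊆ S :=
  fun _ hx => mem_of_minus_ne_plus fun h => hx (congrArg f h)

theorem minus_le_plus (x : unitInterval) : minus S x ≤ plus S x := by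
  simpa using minus_le (plus S x)

theorem plus_lt_minus {x y : unitInterval} (h : x < y) : plus S x < minus S y :=
  lt_iff.2 (Or.inl (by simpa))

/-- By compactness it is enough that the convex component of a level set around any point contains
`x⁻` for at most one jump `x`. If it contained `x⁻` and `y⁻` with `x < y`, it would contain `x⁺`
between them, so `f` would not jump at `x`. -/
theorem jumps_finite (f : C(Disconnection S, ℤ)) : (jumps f).Finite := by
  have hU : ∀ p : Disconnection S, ∃ U ∈ 𝓝 p, ({x | x ∈ jumps f ∧ minus S x ∈ U}).Finite := by
    intro p
    have h1 : f ⁻¹' {f p} ∈ 𝓝 p :=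
      ((isOpen_discrete _).preimage f.continuous).mem_nhds rfl
    refine ⟨_, ordConnectedComponent_mem_nhds.2 h1, Set.Subsingleton.finite ?_⟩
    have key : ∀ x y, x ∈ jumps f → minus S x ∈ ordConnectedComponent (f ⁻¹' {f p}) p →
        minus S y ∈ ordConnectedComponent (f ⁻¹' {f p}) p → ¬ x < y := by
      intro x y hx hxU hyU hlt
      have hsub := mem_ordConnectedComponent.1
        (mem_ordConnectedComponent_trans (mem_ordConnectedComponent_comm.1 hxU) hyU)
      have h2 := hsub (Icc_subset_uIcc ⟨minus_le_plus x, (plus_lt_minus hlt).le⟩)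
      have h3 := ordConnectedComponent_subset hxU
      exact hx (Eq.trans h3 (Eq.symm h2))
    rintro x ⟨hx, hxU⟩ y ⟨hy, hyU⟩
    exact le_antisymm (not_lt.1 (key y x hy hyU hxU)) (not_lt.1 (key x y hx hxU hyU))
  choose U hU hfin using hU
  obtain ⟨t, -, ht⟩ := isCompact_univ.elim_nhds_subcover U fun p _ => hU p
  refine (t.finite_toSet.biUnion fun p _ => hfin p).subset fun x hx => ?_
  obtain ⟨p, hp, hpx⟩ := mem_iUnion₂.1 (ht (mem_univ (minus S x)))
  exact mem_iUnion₂.2 ⟨p, hp, hx, hpx⟩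

/-- This is connectedness of `[x, y]`: a level set and its complement project to two closed sets
that cover `[x, y]`. If both are nonempty they share a point, over which `f` takes two values. -/
theorem eq_of_forall_notMem_jumps (f : C(Disconnection S, ℤ)) {x y : unitInterval} (hx : x ∈ S)
    (hy : y ∈ S) (hxy : x < y) (hf : ∀ z ∈ Ioo x y, z ∉ jumps f) {p q : Disconnection S}
    (hp : p ∈ interval S x y) (hq : q ∈ interval S x y) : f p = f q := by
  by_contra hne
  have hE := isClopen_interval hx hy hxy
  have hV := isClopen_discrete ({f q} : Set ℤ) |>.preimage f.continuous
  have hclosed : ∀ T : Set (Disconnection S), IsClosed T → IsClosed (π '' T) := fun T hT =>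
    (hT.isCompact.image continuous_π).isClosed
  obtain ⟨z, -, ⟨u, ⟨huE, hu⟩, huz⟩, v, ⟨hvE, hv⟩, hvz⟩ :=
    isPreconnected_closed_iff.1 (isPreconnected_Icc (a := x) (b := y))
      (π '' (interval S x y ∩ f ⁻¹' {f q})) (π '' (interval S x y ∩ (f ⁻¹' {f q})ᶜ))
      (hclosed _ (hE.1.inter hV.1)) (hclosed _ (hE.1.inter hV.2.isClosed_compl))
      (by
        rw [← image_union, ← inter_union_distrib_left, union_compl_self, inter_univ,
          image_π_interval hx hxy])
      ⟨q.π, image_π_interval hx hxy ▸ mem_image_of_mem π hq, q, ⟨hq, rfl⟩, rfl⟩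
      ⟨p.π, image_π_interval hx hxy ▸ mem_image_of_mem π hp, p, ⟨hp, hne⟩, rfl⟩
  have huv : u.π = v.π := huz.trans hvz.symm
  apply hv
  refine Eq.trans ?_ hu
  by_contra hne'
  -- `u` and `v` are the two distinct points of one fibre, and an endpoint has only one lift inside
  -- the interval.
  have hz : u.π ∈ Ioo x y := by
    obtain ⟨h1, h2⟩ := (mem_interval hx hxy).1 huE
    obtain ⟨h3, h4⟩ := (mem_interval hx hxy).1 hvE
    rw [← huv] at h3 h4
    have hs : u.side ≠ v.side := fun h => hne' (congrArg f (Disconnection.ext huv h).symm)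
    revert h1 h2 h3 h4 hs
    cases u.side <;> cases v.side <;> simp +contextual [huv]
  exact hne' (apply_eq_of_π_eq huv (not_not.1 (hf _ hz))).symm

/-- The intervals cut out by an increasing sequence from `0` to `1` cover the disconnection. -/
theorem exists_mem_interval {m : ℕ} {b : Fin (m + 1) → unitInterval} (hb : StrictMono b)
    (h0 : b 0 = 0) (h1 : b (Fin.last m) = 1) (hS : ∀ k, b k ∈ S) (p : Disconnection S) :
    ∃ i : Fin m, p ∈ interval S (b i.castSucc) (b i.succ) := by
  by_contra! hcon
  simp only [mem_interval (hS _) (hb (Fin.castSucc_lt_succ)), not_and, not_or] at hcon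
  have key : ∀ k : Fin (m + 1), b k < p.π ∨ (b k = p.π ∧ p.side = true) := by
    intro k
    induction k using Fin.induction with
    | zero =>
      rw [h0]
      rcases eq_or_lt_of_le (unitInterval.nonneg' : 0 ≤ p.π) with h | h
      · refine Or.inr ⟨h, ?_⟩
        by_contra hs
        exact p.left_valid (by simpa using hs) h.symm
      · exact Or.inl h
    | succ i ih =>
      obtain ⟨h1, h2⟩ := hcon i ih
      rcases eq_or_lt_of_le (not_lt.1 h1) with h | h
      · exact Or.inr ⟨h, by simpa using h2 h.symm⟩
      · exact Or.inl h
  have := key (Fin.last m)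
  rw [h1] at this
  rcases this with h | ⟨h, hs⟩
  · exact absurd h (not_lt.2 unitInterval.le_one')
  · exact π_ne_one hs h.symm

theorem interval_index_unique {m : ℕ} {b : Fin (m + 1) → unitInterval} (hb : StrictMono b)
    (hS : ∀ k, b k ∈ S) {p : Disconnection S} {i j : Fin m}
    (hi : p ∈ interval S (b i.castSucc) (b i.succ))
    (hj : p ∈ interval S (b j.castSucc) (b j.succ)) : i = j := by
  have aux : ∀ i j : Fin m, p ∈ interval S (b i.castSucc) (b i.succ) →
      p ∈ interval S (b j.castSucc) (b j.succ) → ¬ i < j := by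
    intro i j hi hj hij
    have h1 := ((mem_interval (hS _) (hb Fin.castSucc_lt_succ)).1 hi).2
    have h2 := ((mem_interval (hS _) (hb Fin.castSucc_lt_succ)).1 hj).1
    have h3 : b i.succ ≤ b j.castSucc := hb.monotone (Fin.succ_le_castSucc_iff.2 hij)
    rcases h1 with h1 | ⟨h1, hs⟩
    · rcases h2 with h2 | ⟨h2, -⟩
      · exact lt_asymm (h1.trans_le h3) h2
      · exact absurd (h1.trans_le h3) (by rw [h2]; exact lt_irrefl _)
    · rcases h2 with h2 | ⟨h2, hs'⟩
      · exact absurd (h3.trans_lt h2) (by rw [h1]; exact lt_irrefl _)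
      · rw [hs] at hs'
        exact Bool.noConfusion hs'
  exact le_antisymm (not_lt.1 (aux j i hj hi)) (not_lt.1 (aux i j hi hj))

end Disconnection

/-! ### One-sided limits of `τ` and the map `σ`. -/

namespace MonotonePartition

variable {τ : unitInterval → unitInterval} (P : MonotonePartition τ)

/-- The side of `p` selects the cell containing `p`, and hence the branch whose value is the limit
of `τ` from that side. This transfers hypotheses on `τ` to `σ` even over points of `C`, where the
value of `τ` is arbitrary. -/
theorem tendsto_sideNhds (p : P.X) : Tendsto τ p.sideNhds (𝓝 (P.σ p).π) := by
  have hp := P.idx_mem p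
  have hmem := Disconnection.Ioo_mem_sideNhds (P.a_mem _) (P.a_lt _) hp
  rw [σ, P.π_branchLift]
  have h1 := P.branch_continuousOn _ _ (P.π_mem hp)
  have h2 : p.sideNhds ≤ 𝓝[Icc (P.a (P.idx p).castSucc) (P.a (P.idx p).succ)] p.π :=
    le_inf p.sideNhds_le (le_principal_iff.2 (mem_of_superset hmem Ioo_subset_Icc_self))
  refine (h1.mono_left h2).congr' ?_
  filter_upwards [hmem] with x hx
  exact P.branch_eq _ hx

theorem exists_cell_Ioo {x : unitInterval} (hx : x ∉ P.C) :
    ∃ i : Fin P.n, x ∈ Ioo (P.a i.castSucc) (P.a i.succ) := by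
  have h := P.π_mem (P.idx_mem (Disconnection.minus P.I₁ x))
  rw [Disconnection.minus_π] at h
  exact ⟨_, lt_of_le_of_ne h.1 fun h => hx ⟨_, h⟩, lt_of_le_of_ne h.2 fun h => hx ⟨_, h.symm⟩⟩

theorem finite_C : P.C.Finite := finite_range _

theorem dense_compl_C : Dense P.Cᶜ := by
  rw [compl_eq_univ_sdiff]
  exact dense_univ.sdiff_finite P.finite_C

theorem continuousAt_of_notMem_C {x : unitInterval} (hx : x ∉ P.C) : ContinuousAt τ x := by
  obtain ⟨i, hi⟩ := P.exists_cell_Ioo hx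
  exact (P.continuousOn i).continuousAt (Ioo_mem_nhds hi.1 hi.2)

theorem π_σ_of_notMem_C {p : P.X} (hp : p.π ∉ P.C) : (P.σ p).π = τ p.π := by
  have := p.sideNhds_neBot
  exact tendsto_nhds_unique (P.tendsto_sideNhds p)
    ((P.continuousAt_of_notMem_C hp).tendsto.mono_left p.sideNhds_le)

/-- Every interval meets an open interval of strict monotonicity. This is what upgrades the weak
monotonicity in a Markov partition. -/
theorem exists_τ_ne (P : MonotonePartition τ) {x y : unitInterval} (h : x < y) :
    ∃ u v, x < u ∧ u < v ∧ v < y ∧ τ u ≠ τ v := by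
  obtain ⟨z, hzC, hz⟩ := P.dense_compl_C.exists_mem_open isOpen_Ioo (nonempty_Ioo.2 h)
  obtain ⟨i, hi⟩ := P.exists_cell_Ioo hzC
  obtain ⟨u, hu1, hu2⟩ := exists_between (max_lt hi.1 hz.1)
  have hu := max_lt_iff.1 hu1
  refine ⟨u, z, hu.2, hu2, hz.2, fun heq => hu2.ne ?_⟩
  have hui : u ∈ Ioo (P.a i.castSucc) (P.a i.succ) := ⟨hu.1, hu2.trans hi.2⟩
  exact (P.monotonic i).elim (fun h => h.injOn hui hi heq) fun h => h.injOn hui hi heq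

theorem hat_of_notMem_C {x y : unitInterval} (hx : x ∉ P.C) (hy : y ∈ hat τ x) : y = τ x := by
  have hc := (P.continuousAt_of_notMem_C hx).tendsto
  rcases hy with ⟨h0, hy⟩ | ⟨h1, hy⟩
  · have := nhdsLT_neBot_of_exists_lt ⟨0, lt_of_le_of_ne unitInterval.nonneg' h0.symm⟩
    exact tendsto_nhds_unique hy (hc.mono_left nhdsWithin_le_nhds)
  · have := nhdsGT_neBot_of_exists_gt ⟨1, lt_of_le_of_ne unitInterval.le_one' h1⟩
    exact tendsto_nhds_unique hy (hc.mono_left nhdsWithin_le_nhds)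

theorem π_σ_mem_hat (p : P.X) : (P.σ p).π ∈ hat τ p.π := by
  rw [σ, P.π_branchLift]
  exact P.branch_mem_hat _ (P.π_mem (P.idx_mem p))

end MonotonePartition

/-! ### The Markov partition of `X`: injectivity of `σ` on `E_i` and the Markov property. -/

namespace MarkovPartition

variable {τ : unitInterval → unitInterval} {P : MonotonePartition τ} (B : MarkovPartition P)

theorem b_lt (i : Fin B.q) : B.b i.castSucc < B.b i.succ := B.strictMono i.castSucc_lt_succ

theorem exists_mem_E (p : P.X) : ∃ i, p ∈ B.E i :=
  Disconnection.exists_mem_interval B.strictMono B.b_zero B.b_last B.b_mem p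

theorem E_unique {p : P.X} {i j : Fin B.q} (hi : p ∈ B.E i) (hj : p ∈ B.E j) : i = j :=
  Disconnection.interval_index_unique B.strictMono B.b_mem hi hj

theorem image_π_E (i : Fin B.q) :
    Disconnection.π '' B.E i = Icc (B.b i.castSucc) (B.b i.succ) :=
  Disconnection.image_π_interval (B.b_mem _) (B.b_lt i)

theorem E_nonempty (i : Fin B.q) : (B.E i).Nonempty := by
  rw [← image_nonempty (f := Disconnection.π), B.image_π_E]
  exact nonempty_Icc.2 (B.b_lt i).le

theorem mem_E_of_mem_Ioo {i : Fin B.q} {p : P.X}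
    (hp : p.π ∈ Ioo (B.b i.castSucc) (B.b i.succ)) : p ∈ B.E i :=
  Disconnection.mem_interval_of_mem_Ioo (B.b_mem _) hp

theorem Ioo_mem_sideNhds {i : Fin B.q} {p : P.X} (hp : p ∈ B.E i) :
    Ioo (B.b i.castSucc) (B.b i.succ) ∈ p.sideNhds :=
  Disconnection.Ioo_mem_sideNhds (B.b_mem _) (B.b_lt i) hp

theorem π_mem_Icc {i : Fin B.q} {p : P.X} (hp : p ∈ B.E i) :
    p.π ∈ Icc (B.b i.castSucc) (B.b i.succ) :=
  B.image_π_E i ▸ mem_image_of_mem _ hp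

/-- Both projections are one-sided limits of `τ`. By monotonicity they are separated by two values
`τ u ≠ τ v` taken strictly between the base points. -/
theorem π_σ_ne {i : Fin B.q} {p p' : P.X} (hp : p ∈ B.E i) (hp' : p' ∈ B.E i)
    (h : p.π < p'.π) : (P.σ p).π ≠ (P.σ p').π := by
  intro heq
  obtain ⟨u, v, hu, huv, hv, hne⟩ := P.exists_τ_ne h
  have := p.sideNhds_neBot
  have := p'.sideNhds_neBot
  have hb := B.π_mem_Icc hp
  have hb' := B.π_mem_Icc hp'
  have hui : u ∈ Ioo (B.b i.castSucc) (B.b i.succ) :=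
    ⟨hb.1.trans_lt hu, (huv.trans hv).trans_le hb'.2⟩
  have hvi : v ∈ Ioo (B.b i.castSucc) (B.b i.succ) :=
    ⟨(hb.1.trans_lt hu).trans huv, hv.trans_le hb'.2⟩
  have e1 := p.sideNhds_le (Iio_mem_nhds hu)
  have e2 := p'.sideNhds_le (Ioi_mem_nhds hv)
  have e3 := B.Ioo_mem_sideNhds hp
  have e4 := B.Ioo_mem_sideNhds hp'
  apply hne
  rcases B.monotonic i with hm | hm
  · have h1 : (P.σ p).π ≤ τ u := le_of_tendsto (P.tendsto_sideNhds p) (by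
      filter_upwards [e1, e3] with s hs hs' using hm hs' hui (le_of_lt hs))
    have h2 : τ v ≤ (P.σ p').π := ge_of_tendsto (P.tendsto_sideNhds p') (by
      filter_upwards [e2, e4] with s hs hs' using hm hvi hs' (le_of_lt hs))
    exact le_antisymm (hm hui hvi huv.le) (h2.trans (heq ▸ h1))
  · have h1 : τ u ≤ (P.σ p).π := ge_of_tendsto (P.tendsto_sideNhds p) (by
      filter_upwards [e1, e3] with s hs hs' using hm hs' hui (le_of_lt hs))
    have h2 : (P.σ p').π ≤ τ v := le_of_tendsto (P.tendsto_sideNhds p') (by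
      filter_upwards [e2, e4] with s hs hs' using hm hvi hs' (le_of_lt hs))
    exact le_antisymm (h1.trans (heq ▸ h2)) (hm hui hvi huv.le)

theorem π_eq_of_π_σ_eq {i : Fin B.q} {p p' : P.X} (hp : p ∈ B.E i) (hp' : p' ∈ B.E i)
    (h : (P.σ p).π = (P.σ p').π) : p.π = p'.π := by
  rcases lt_trichotomy p.π p'.π with h1 | h1 | h1
  · exact absurd h (B.π_σ_ne hp hp' h1)
  · exact h1
  · exact absurd h.symm (B.π_σ_ne hp' hp h1)

/-- If the images agreed, `p` and `p'` would be adjacent points of one fibre. The images of `E_i ∩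
{· < p'}` and `E_i ∩ {· > p}` are open and both contain `σ p`, so they share a point over some `x`
other than `π (σ p)`. Its preimages `u ≤ p` and `v ≥ p'` lie in one fibre of `π`, which squeezes `u`
to `p`, a contradiction. -/
theorem σ_ne_of_lt {i : Fin B.q} {p p' : P.X} (hp : p ∈ B.E i) (hp' : p' ∈ B.E i)
    (hlt : p < p') : P.σ p ≠ P.σ p' := by
  intro h
  have hπ : p.π = p'.π := B.π_eq_of_π_σ_eq hp hp' (congrArg _ h)
  -- the images of the parts of `E_i` to the left and to the right of the gap between `p` and `p'`
  have hgap : ∀ r : P.X, p < r → p' ≤ r := by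
    intro r hr
    rcases Disconnection.lt_iff.1 hlt with h1 | ⟨-, h1⟩
    · exact absurd hπ h1.ne
    rcases Disconnection.lt_iff.1 hr with h2 | ⟨h2, h3⟩
    · exact Disconnection.le_iff.2 (Or.inl (hπ ▸ h2))
    · refine Disconnection.le_iff.2 (Or.inr ⟨hπ.symm.trans h2, ?_⟩)
      revert h1 h3
      cases p.side <;> cases p'.side <;> cases r.side <;> simp
  obtain ⟨x, hx, hfib⟩ := Disconnection.exists_π_ne_of_isOpen
    ((P.isPiecewiseHomeo.isOpenMap _ ((B.isClopen_E i).2.inter (isOpen_Iio (a := p')))).inter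
      (P.isPiecewiseHomeo.isOpenMap _ ((B.isClopen_E i).2.inter (isOpen_Ioi (a := p)))))
    (p := P.σ p) ⟨⟨p, ⟨hp, hlt⟩, rfl⟩, p', ⟨hp', hlt⟩, h.symm⟩
  obtain ⟨⟨u, ⟨hu, hup⟩, hux⟩, v, ⟨hv, hvp⟩, hvx⟩ := hfib _ (Disconnection.minus_π x)
  have huv : u.π = v.π := B.π_eq_of_π_σ_eq hu hv (by rw [hux, hvx])
  have h1 : u.π ≤ p.π := Disconnection.π_mono (not_lt.1 fun hc => not_le.2 hup (hgap u hc))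
  have h2 : p.π ≤ v.π := Disconnection.π_mono (le_of_lt hvp)
  have hup : u.π = p.π := le_antisymm h1 (huv ▸ h2)
  have hup' : u = p := by
    by_contra hne
    have hlt : u < p :=
      lt_of_le_of_ne (not_lt.1 fun hc => not_le.2 ‹u ∈ Iio p'› (hgap u hc)) hne
    rcases Disconnection.lt_iff.1 hlt with h1 | ⟨-, h1⟩
    · exact h1.ne hup
    · rcases Disconnection.lt_iff.1 ‹p < p'› with h2 | ⟨-, h2⟩
      · exact h2.ne hπ
      · revert h1 h2
        cases p.side <;> cases p'.side <;> cases u.side <;> simp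
  apply hx
  rw [← hup', hux, Disconnection.minus_π]

theorem injOn_σ (i : Fin B.q) : InjOn P.σ (B.E i) := by
  intro p hp p' hp' h
  rcases lt_trichotomy p p' with h1 | h1 | h1
  · exact absurd h (B.σ_ne_of_lt hp hp' h1)
  · exact h1
  · exact absurd h.symm (B.σ_ne_of_lt hp' hp h1)

/-- The left side is compact and consists of one-sided limits of `τ`. It can miss at most the values
of `τ` on the finite set `C`. -/
theorem image_π_σ (i : Fin B.q) : (fun p => (P.σ p).π) '' B.E i =
    closure (τ '' Ioo (B.b i.castSucc) (B.b i.succ)) := by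
  refine Subset.antisymm ?_ ?_
  · rintro _ ⟨p, hp, rfl⟩
    have := p.sideNhds_neBot
    refine mem_closure_of_tendsto (P.tendsto_sideNhds p) ?_
    filter_upwards [B.Ioo_mem_sideNhds hp] with x hx using mem_image_of_mem τ hx
  · obtain ⟨J, hJ⟩ := B.closure_image i
    have hcl : IsClosed ((fun p => (P.σ p).π) '' B.E i) :=
      ((B.isClopen_E i).1.isCompact.image
        (Disconnection.continuous_π.comp P.isPiecewiseHomeo.continuous)).isClosed
    have hsub : closure (τ '' Ioo (B.b i.castSucc) (B.b i.succ)) ⊆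
        (fun p => (P.σ p).π) '' B.E i ∪ τ '' P.C := by
      refine closure_minimal ?_ (hcl.union (P.finite_C.image τ).isClosed)
      rintro _ ⟨x, hx, rfl⟩
      by_cases hxC : x ∈ P.C
      · exact Or.inr ⟨x, hxC, rfl⟩
      · refine Or.inl ⟨Disconnection.minus P.I₁ x, B.mem_E_of_mem_Ioo (by simpa), ?_⟩
        have := P.π_σ_of_notMem_C (p := Disconnection.minus P.I₁ x) (by simpa)
        simpa using this
    -- The finitely many exceptional values do no harm: the closure is a union of nondegenerate
    -- intervals, in which the other points are dense.
    have hd : Dense (τ '' P.C)ᶜ := by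
      rw [compl_eq_univ_sdiff]
      exact dense_univ.sdiff_finite (P.finite_C.image τ)
    rw [hJ] at hsub ⊢
    refine iUnion₂_subset fun j hj => ?_
    rw [← closure_Ioo (B.b_lt j).ne]
    refine closure_minimal ((hd.open_subset_closure_inter isOpen_Ioo).trans
      (closure_minimal ?_ hcl)) hcl
    rintro x ⟨hx, hxC⟩
    exact (hsub (mem_iUnion₂.2 ⟨j, hj, Ioo_subset_Icc_self hx⟩)).resolve_right hxC

theorem isClopen_image_σ {F : Set P.X} (hF : IsClopen F) : IsClopen (P.σ '' F) :=
  ⟨(hF.1.isCompact.image P.isPiecewiseHomeo.continuous).isClosed,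
    P.isPiecewiseHomeo.isOpenMap _ hF.2⟩

theorem exists_image_σ_eq (i : Fin B.q) : ∃ J : Set (Fin B.q), P.σ '' B.E i = ⋃ j ∈ J, B.E j := by
  obtain ⟨J, hJ⟩ := B.closure_image i
  have h : Disconnection.π '' (P.σ '' B.E i) = Disconnection.π '' (⋃ j ∈ J, B.E j) := by
    rw [image_image, B.image_π_σ, hJ, image_iUnion₂]
    simp only [image_π_E]
  have h1 := isClopen_image_σ (B.isClopen_E i)
  have h2 : IsClopen (⋃ j ∈ J, B.E j) := J.toFinite.isClopen_biUnion fun j _ => B.isClopen_E j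
  exact ⟨J, Subset.antisymm (Disconnection.subset_of_image_π_subset h1.2 h2.1 h.subset)
    (Disconnection.subset_of_image_π_subset h2.2 h1.1 h.superset)⟩

/-- The Markov property. -/
theorem E_subset_image_σ {i j : Fin B.q} {p : P.X} (hp : p ∈ B.E i) (h : P.σ p ∈ B.E j) :
    B.E j ⊆ P.σ '' B.E i := by
  obtain ⟨J, hJ⟩ := B.exists_image_σ_eq i
  have hmem := mem_image_of_mem P.σ hp
  rw [hJ] at hmem ⊢
  obtain ⟨k, hk, hpk⟩ := mem_iUnion₂.1 hmem
  rw [B.E_unique h hpk]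
  exact subset_biUnion_of_mem hk

end MarkovPartition

/-! ### Orbits under `τ̂`: every point of `I₁` ends up in the Markov partition points. -/

theorem hatImage_mono (τ : unitInterval → unitInterval) : Monotone (hatImage τ) :=
  fun _ _ h => biUnion_subset_biUnion_left h

theorem hatImage_iterate_union (τ : unitInterval → unitInterval) (n : ℕ)
    (T T' : Set unitInterval) :
    (hatImage τ)^[n] (T ∪ T') = (hatImage τ)^[n] T ∪ (hatImage τ)^[n] T' := by
  induction n generalizing T T' with
  | zero => rfl
  | succ n ih =>
    rw [Function.iterate_succ_apply, Function.iterate_succ_apply, Function.iterate_succ_apply, ← ih]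
    congr 1
    exact biUnion_union _ _ _

namespace MarkovPartition

variable {τ : unitInterval → unitInterval} {P : MonotonePartition τ} (B : MarkovPartition P)

/-- The closure of the image is a union of intervals `[b_{j-1}, b_j]`, so its minimum and maximum
are endpoints of such intervals. -/
theorem mem_range_b_of_extremal {i : Fin B.q} {y : unitInterval}
    (hy : y ∈ closure (τ '' Ioo (B.b i.castSucc) (B.b i.succ)))
    (h : (∀ u ∈ Ioo (B.b i.castSucc) (B.b i.succ), y ≤ τ u) ∨
      ∀ u ∈ Ioo (B.b i.castSucc) (B.b i.succ), τ u ≤ y) : y ∈ range B.b := by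
  obtain ⟨J, hJ⟩ := B.closure_image i
  have hy' := hy
  rw [hJ] at hy'
  obtain ⟨j, hj, hyj⟩ := mem_iUnion₂.1 hy'
  have hsub : Icc (B.b j.castSucc) (B.b j.succ) ⊆
      closure (τ '' Ioo (B.b i.castSucc) (B.b i.succ)) := by
    rw [hJ]
    exact subset_biUnion_of_mem (u := fun j => Icc (B.b (Fin.castSucc j)) (B.b j.succ)) hj
  rcases h with h | h
  · have h1 : closure (τ '' Ioo (B.b i.castSucc) (B.b i.succ)) ⊆ Ici y :=
      closure_minimal (by rintro _ ⟨u, hu, rfl⟩; exact h u hu) isClosed_Ici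
    exact ⟨_, le_antisymm hyj.1 (h1 (hsub (left_mem_Icc.2 (B.b_lt j).le)))⟩
  · have h1 : closure (τ '' Ioo (B.b i.castSucc) (B.b i.succ)) ⊆ Iic y :=
      closure_minimal (by rintro _ ⟨u, hu, rfl⟩; exact h u hu) isClosed_Iic
    exact ⟨_, le_antisymm (h1 (hsub (right_mem_Icc.2 (B.b_lt j).le))) hyj.2⟩

/-- The last hypothesis places `l` at one end of the Markov interval. By monotonicity the limit
there is an extremal value. -/
theorem mem_range_b_of_tendsto {i : Fin B.q} {y : unitInterval} {l : Filter unitInterval}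
    [l.NeBot] (hy : Tendsto τ l (𝓝 y)) (hl : Ioo (B.b i.castSucc) (B.b i.succ) ∈ l)
    (h : (∀ u ∈ Ioo (B.b i.castSucc) (B.b i.succ), Iio u ∈ l) ∨
      ∀ u ∈ Ioo (B.b i.castSucc) (B.b i.succ), Ioi u ∈ l) : y ∈ range B.b := by
  refine B.mem_range_b_of_extremal (i := i)
    (mem_closure_of_tendsto hy (mem_of_superset hl (subset_preimage_image τ _))) ?_
  rcases h with h | h <;> rcases B.monotonic i with hm | hm
  · refine Or.inl fun u hu => le_of_tendsto hy ?_
    filter_upwards [h u hu, hl] with s hs hs' using hm hs' hu (le_of_lt hs)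
  · refine Or.inr fun u hu => ge_of_tendsto hy ?_
    filter_upwards [h u hu, hl] with s hs hs' using hm hs' hu (le_of_lt hs)
  · refine Or.inr fun u hu => ge_of_tendsto hy ?_
    filter_upwards [h u hu, hl] with s hs hs' using hm hu hs' (le_of_lt hs)
  · refine Or.inl fun u hu => le_of_tendsto hy ?_
    filter_upwards [h u hu, hl] with s hs hs' using hm hu hs' (le_of_lt hs)

theorem hatImage_range_b : hatImage τ (range B.b) ⊆ range B.b := by
  refine iUnion₂_subset ?_
  rintro _ ⟨k, rfl⟩ y (⟨h0, hy⟩ | ⟨h1, hy⟩)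
  · obtain ⟨i, rfl⟩ := Fin.exists_succ_eq.2 fun h : k = 0 => h0 (h ▸ B.b_zero)
    have := nhdsLT_neBot_of_exists_lt ⟨_, B.b_lt i⟩
    exact B.mem_range_b_of_tendsto hy (Ioo_mem_nhdsLT (B.b_lt i))
      (Or.inr fun u hu => mem_nhdsWithin_of_mem_nhds (Ioi_mem_nhds hu.2))
  · obtain ⟨i, rfl⟩ := Fin.exists_castSucc_eq.2 fun h : k = Fin.last _ => h1 (h ▸ B.b_last)
    have := nhdsGT_neBot_of_exists_gt ⟨_, B.b_lt i⟩
    exact B.mem_range_b_of_tendsto hy (Ioo_mem_nhdsGT (B.b_lt i))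
      (Or.inl fun u hu => mem_nhdsWithin_of_mem_nhds (Iio_mem_nhds hu.1))

theorem hatImage_iterate_subset_of_le {T : Set unitInterval} {m n : ℕ} (hmn : m ≤ n)
    (h : (hatImage τ)^[m] T ⊆ range B.b) : (hatImage τ)^[n] T ⊆ range B.b := by
  induction n, hmn using Nat.le_induction with
  | base => exact h
  | succ n _ ih =>
    rw [Function.iterate_succ_apply']
    exact (hatImage_mono τ ih).trans B.hatImage_range_b

/-- By minimality of `I₁`, it is enough that the set of points with this property contains `C` and
is closed under `τ̂` and `τ̂⁻¹`. -/
theorem exists_hatImage_iterate_subset {x : unitInterval} (hx : x ∈ P.I₁) :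
    ∃ n, (hatImage τ)^[n] {x} ⊆ range B.b := by
  refine hx {x | ∃ n, (hatImage τ)^[n] {x} ⊆ range B.b} ?_
  obtain ⟨k, hk⟩ := B.orbit
  have hC : P.C ⊆ {x | ∃ n, (hatImage τ)^[n] {x} ⊆ range B.b} := fun x hx =>
    ⟨k, ((hatImage_mono τ).iterate k (singleton_subset_iff.2 hx)).trans hk⟩
  refine ⟨hC, ?_, ?_⟩
  · refine iUnion₂_subset ?_
    rintro x ⟨n, hn⟩ y hy
    have h1 := B.hatImage_iterate_subset_of_le n.le_succ hn
    rw [Function.iterate_succ_apply] at h1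
    refine ⟨n, ((hatImage_mono τ).iterate n (singleton_subset_iff.2 ?_)).trans h1⟩
    exact mem_biUnion (mem_singleton x) hy
  · rintro x ⟨y, hy, n, hn⟩
    -- Off `C` the set `τ̂(x)` has no element besides `τ x`, so one good element of `τ̂(x)` is
    -- enough. A point of `C` may have two different limits, but it is covered by the orbit
    -- condition.
    by_cases hxC : x ∈ P.C
    · exact hC hxC
    refine ⟨n + 1, ?_⟩
    rw [Function.iterate_succ_apply]
    refine ((hatImage_mono τ).iterate n ?_).trans hn
    rw [P.hat_of_notMem_C hxC hy]
    refine iUnion₂_subset ?_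
    rintro _ rfl z hz
    exact P.hat_of_notMem_C hxC hz

theorem exists_hatImage_iterate_subset_of_finite {T : Set unitInterval} (hT : T.Finite)
    (hTI : T ⊆ P.I₁) : ∃ n, (hatImage τ)^[n] T ⊆ range B.b := by
  induction T, hT using Set.Finite.induction_on with
  | empty => exact ⟨0, empty_subset _⟩
  | @insert x T _ _ ih =>
    obtain ⟨n, hn⟩ := ih ((subset_insert _ _).trans hTI)
    obtain ⟨m, hm⟩ := B.exists_hatImage_iterate_subset (hTI (mem_insert _ _))
    refine ⟨m + n, ?_⟩
    rw [insert_eq, hatImage_iterate_union]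
    exact union_subset (B.hatImage_iterate_subset_of_le (Nat.le_add_right _ _) hm)
      (B.hatImage_iterate_subset_of_le (Nat.le_add_left _ _) hn)

/-! ### Step functions on the Markov partition and the transfer map. -/

theorem ψ_apply (v : Fin B.q → ℤ) {j : Fin B.q} {p : P.X} (hp : p ∈ B.E j) : B.ψ v p = v j := by
  have h : ∀ i, B.χ i p = if i = j then 1 else 0 := by
    intro i
    change (B.E i).indicator 1 p = _
    split_ifs with hij
    · rw [hij, indicator_of_mem hp, Pi.one_apply]
    · exact indicator_of_notMem (fun hi => hij (B.E_unique hi hp)) _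
  simp [ψ, ContinuousMap.sum_apply, h]

theorem ext_E {f g : C(P.X, ℤ)} (h : ∀ j, ∀ p ∈ B.E j, f p = g p) : f = g := by
  ext p
  obtain ⟨j, hj⟩ := B.exists_mem_E p
  exact h j p hj

theorem exists_eq_ψ {f : C(P.X, ℤ)} (hf : Disconnection.jumps f ⊆ range B.b) :
    ∃ v, f = B.ψ v := by
  refine ⟨fun j => f (B.E_nonempty j).some, B.ext_E fun j p hp => ?_⟩
  rw [B.ψ_apply _ hp]
  refine Disconnection.eq_of_forall_notMem_jumps f (B.b_mem _) (B.b_mem _) (B.b_lt j) ?_ hp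
    (B.E_nonempty j).some_mem
  rintro z hz hzf
  obtain ⟨k, rfl⟩ := hf hzf
  have h1 := B.strictMono.lt_iff_lt.1 hz.1
  have h2 := B.strictMono.lt_iff_lt.1 hz.2
  exact absurd h2 (not_lt.2 (Fin.castSucc_lt_iff_succ_le.1 h1))

theorem ψ_nonneg_iff {v : Fin B.q → ℤ} : 0 ≤ B.ψ v ↔ 0 ≤ v := by
  constructor
  · intro h j
    exact (h (B.E_nonempty j).some).trans_eq (B.ψ_apply _ (B.E_nonempty j).some_mem)
  · intro h p
    obtain ⟨j, hj⟩ := B.exists_mem_E p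
    exact (h j).trans_eq (B.ψ_apply _ hj).symm

theorem ψ_injective : Function.Injective B.ψ := by
  intro v w h
  funext j
  rw [← B.ψ_apply v (B.E_nonempty j).some_mem, h, B.ψ_apply w (B.E_nonempty j).some_mem]

/-- The value of the transfer map at a point of `E_j`, in terms of the values `c i` of the function
at the preimages in `E_i`. -/
theorem transferFun_eq (f : P.X → ℤ) {j : Fin B.q} {r : P.X} (hr : r ∈ B.E j) (c : Fin B.q → ℤ)
    (hc : ∀ i, ∀ p ∈ B.E i, P.σ p = r → f p = c i) :
    transferFun P.σ f r = ∑ i, c i * B.A i j := by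
  have h1 : P.σ ⁻¹' {r} = ⋃ i, (P.σ ⁻¹' {r} ∩ B.E i) := by
    rw [← inter_iUnion, eq_univ_of_forall fun p => mem_iUnion.2 (B.exists_mem_E p), inter_univ]
  unfold transferFun
  rw [h1, finsum_mem_iUnion, finsum_eq_sum_of_fintype]
  · refine Finset.sum_congr rfl fun i _ => ?_
    by_cases h : B.E j ⊆ P.σ '' B.E i
    · obtain ⟨p, hp, hpr⟩ := h hr
      have h2 : P.σ ⁻¹' {r} ∩ B.E i = {p} := by
        ext z
        constructor
        · rintro ⟨hz, hzi⟩
          exact B.injOn_σ i hzi hp (Eq.trans hz hpr.symm)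
        · rintro rfl
          exact ⟨hpr, hp⟩
      rw [h2, finsum_mem_singleton, hc i p hp hpr]
      simp [A, h]
    · have h2 : P.σ ⁻¹' {r} ∩ B.E i = ∅ := by
        ext z
        simp only [mem_inter_iff, mem_preimage, mem_singleton_iff, mem_empty_iff_false, iff_false]
        rintro ⟨rfl, hzi⟩
        exact h (B.E_subset_image_σ hzi hr)
      rw [h2, finsum_mem_empty]
      simp [A, h]
  · intro i k hik
    exact Set.disjoint_left.2 fun p hi hk => hik (B.E_unique hi.2 hk.2)
  · exact fun i => (P.isPiecewiseHomeo.finite_fiber r).subset inter_subset_left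

theorem transfer_ψ (v : Fin B.q → ℤ) :
    transfer P.isPiecewiseHomeo (B.ψ v) = B.ψ (Matrix.vecMul v B.A) := by
  refine B.ext_E fun j r hr => ?_
  rw [B.ψ_apply _ hr]
  exact B.transferFun_eq _ hr v fun i p hp _ => B.ψ_apply v hp

/-- If `y` is not a partition point, then `y⁻` and `y⁺` lie in the same `E_j`, so their preimages
pair up inside each `E_i`, and the two points of a pair lie in one fibre of `π`. The two sums can
differ only if `f` jumps across such a fibre, and `τ̂` sends its base point to `y`. -/
theorem jumps_transfer_subset (f : C(P.X, ℤ)) :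
    Disconnection.jumps (transfer P.isPiecewiseHomeo f) ⊆
      range B.b ∪ hatImage τ (Disconnection.jumps f) := by
  classical
  intro y hy
  by_contra hcon
  obtain ⟨hyb, hyf⟩ := not_or.1 hcon
  obtain ⟨j, hj⟩ := B.exists_mem_E (Disconnection.minus P.I₁ y)
  have hIcc := B.π_mem_Icc hj
  rw [Disconnection.minus_π] at hIcc
  have hj' : Disconnection.plus P.I₁ y ∈ B.E j := B.mem_E_of_mem_Ioo (by
    rw [Disconnection.plus_π]
    exact ⟨lt_of_le_of_ne hIcc.1 fun h => hyb ⟨_, h⟩,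
      lt_of_le_of_ne hIcc.2 fun h => hyb ⟨_, h.symm⟩⟩)
  -- The value of `f` at the preimage of `y⁻` in `E_i`. The default `0` occurs only when `σ(E_i)`
  -- misses `E_j`, where it is multiplied by `A i j = 0`. The same `c` will serve for `y⁺`.
  let c : Fin B.q → ℤ := fun i =>
    if h : ∃ p ∈ B.E i, P.σ p = Disconnection.minus P.I₁ y then f h.choose else 0
  have hc : ∀ i, ∀ p ∈ B.E i, P.σ p = Disconnection.minus P.I₁ y → f p = c i := by
    intro i p hp hpy
    have h : ∃ p ∈ B.E i, P.σ p = Disconnection.minus P.I₁ y := ⟨p, hp, hpy⟩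
    simp only [c, dif_pos h]
    rw [B.injOn_σ i hp h.choose_spec.1 (hpy.trans h.choose_spec.2.symm)]
  have hc' : ∀ i, ∀ p ∈ B.E i, P.σ p = Disconnection.plus P.I₁ y → f p = c i := by
    intro i p hp hpy
    obtain ⟨p', hp', hpy'⟩ := B.E_subset_image_σ hp (hpy ▸ hj') hj
    rw [← hc i p' hp' hpy']
    have hπ := B.π_eq_of_π_σ_eq hp hp' (by rw [hpy, hpy']; simp)
    refine Disconnection.apply_eq_of_π_eq hπ (not_not.1 fun hx => hyf ?_)
    refine mem_biUnion (x := p.π) hx ?_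
    have := P.π_σ_mem_hat p
    rwa [hpy, Disconnection.plus_π] at this
  exact hy ((B.transferFun_eq f hj c hc).trans (B.transferFun_eq f hj' c hc').symm)

/-- Jumps created at partition points stay there, because `τ̂` maps the set of these points into
itself. -/
theorem jumps_transfer_iterate_subset (f : C(P.X, ℤ)) (n : ℕ) :
    Disconnection.jumps ((transfer P.isPiecewiseHomeo)^[n] f) ⊆
      range B.b ∪ (hatImage τ)^[n] (Disconnection.jumps f) := by
  induction n with
  | zero => exact subset_union_right
  | succ n ih =>
    rw [Function.iterate_succ_apply', Function.iterate_succ_apply']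
    refine (B.jumps_transfer_subset _).trans (union_subset subset_union_left ?_)
    refine (hatImage_mono τ ih).trans ?_
    rw [hatImage, biUnion_union]
    exact union_subset_union_left _ B.hatImage_range_b

theorem exists_transfer_iterate_eq_ψ (f : C(P.X, ℤ)) :
    ∃ n v, (transfer P.isPiecewiseHomeo)^[n] f = B.ψ v := by
  obtain ⟨n, hn⟩ := B.exists_hatImage_iterate_subset_of_finite (Disconnection.jumps_finite f)
    (Disconnection.jumps_subset f)
  exact ⟨n, B.exists_eq_ψ ((B.jumps_transfer_iterate_subset f n).trans (union_subset le_rfl hn))⟩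

end MarkovPartition

/-! ### Positivity and supports of transfers, and injectivity of `𝓛_*`, for a general piecewise
homeomorphism. -/

theorem transferFun_eq_zero {X : Type*} {σ : X → X} {f : X → ℤ} {x : X}
    (h : ∀ y, σ y = x → f y = 0) : transferFun σ f x = 0 :=
  finsum_mem_eq_zero_of_forall_eq_zero h

theorem transferFun_nonneg {X : Type*} {σ : X → X} {f : X → ℤ} (hf : 0 ≤ f) :
    0 ≤ transferFun σ f :=
  fun _ => finsum_nonneg fun y => finsum_nonneg fun _ => hf y

section DimensionGroup

variable {X : Type*} [TopologicalSpace X] [CompactSpace X] [T2Space X] {σ : X → X}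
  (hσ : IsPiecewiseHomeo σ)

theorem transfer_nonneg {f : C(X, ℤ)} (hf : 0 ≤ f) : 0 ≤ transfer hσ f :=
  transferFun_nonneg (f := f) hf

theorem transfer_iterate_nonneg {f : C(X, ℤ)} (hf : 0 ≤ f) (n : ℕ) :
    0 ≤ (transfer hσ)^[n] f := by
  induction n with
  | zero => exact hf
  | succ n ih =>
    rw [Function.iterate_succ_apply']
    exact transfer_nonneg hσ ih

theorem transfer_iterate_apply_eq_zero (f : C(X, ℤ)) (n : ℕ) {x : X} (hx : x ∉ range σ^[n]) :
    (transfer hσ)^[n] f x = 0 := by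
  induction n generalizing x with
  | zero => exact absurd ⟨x, rfl⟩ hx
  | succ n ih =>
    rw [Function.iterate_succ_apply']
    refine transferFun_eq_zero fun y hy => ih ?_
    rintro ⟨z, rfl⟩
    exact hx ⟨z, by rw [Function.iterate_succ_apply', hy]⟩

theorem DimGroup.mk_eq_mk {f g : C(X, ℤ)} :
    DimGroup.mk hσ f = DimGroup.mk hσ g ↔ ∃ n, (transfer hσ)^[n] f = (transfer hσ)^[n] g :=
  AddCon.eq (transferCon hσ)

theorem DimGroup.mk_surjective : Function.Surjective (DimGroup.mk hσ) :=
  AddCon.mk'_surjective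

theorem DimGroup.endo_iterate_mk (f : C(X, ℤ)) (n : ℕ) :
    (DimGroup.endo hσ)^[n] (DimGroup.mk hσ f) = DimGroup.mk hσ ((transfer hσ)^[n] f) := by
  induction n with
  | zero => rfl
  | succ n ih => rw [Function.iterate_succ_apply', Function.iterate_succ_apply', ih, endo_mk]

/-- If `𝓛 f` and `𝓛 g` agree after `n` transfers, then `f` and `g` agree after `n + 1`. -/
theorem DimGroup.endo_injective : Function.Injective (DimGroup.endo hσ) := by
  intro x y h
  obtain ⟨f, rfl⟩ := DimGroup.mk_surjective hσ x
  obtain ⟨g, rfl⟩ := DimGroup.mk_surjective hσ y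
  rw [endo_mk, endo_mk, mk_eq_mk] at h
  obtain ⟨n, hn⟩ := h
  exact (mk_eq_mk hσ).2 ⟨n + 1, hn⟩

end DimensionGroup

/-! ### Surjectivity of `𝓛_*`, with control of positivity. -/

namespace MarkovPartition

variable {τ : unitInterval → unitInterval} {P : MonotonePartition τ} (B : MarkovPartition P)

/-- A set is a union of members of the Markov partition. -/
def IsSaturated (Y : Set P.X) : Prop := ∀ j, ∀ p ∈ B.E j, p ∈ Y → B.E j ⊆ Y

theorem isSaturated_range_iterate (n : ℕ) : B.IsSaturated (range P.σ^[n]) := by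
  induction n with
  | zero => exact fun j p _ _ q _ => ⟨q, rfl⟩
  | succ n ih =>
    rw [Function.iterate_succ', range_comp]
    rintro j _ hp ⟨p, hpY, rfl⟩
    obtain ⟨i, hi⟩ := B.exists_mem_E p
    exact (B.E_subset_image_σ hi hp).trans (image_mono (ih i p hi hpY))

/-- The ranges of the iterates of `σ` stabilize. -/
theorem exists_range_iterate_subset (B : MarkovPartition P) :
    ∃ N, range P.σ^[N] ⊆ P.σ '' range P.σ^[N] := by
  have hanti : ∀ m n, m ≤ n → range P.σ^[n] ⊆ range P.σ^[m] := by
    intro m n h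
    obtain ⟨k, rfl⟩ := Nat.exists_eq_add_of_le h
    rw [Function.iterate_add]
    exact range_comp_subset_range _ _
  -- The ranges are saturated, so they are encoded by a decreasing sequence of subsets of a finite
  -- index set, which is eventually constant.
  let J : ℕ →o (Set (Fin B.q))ᵒᵈ :=
    ⟨fun n => OrderDual.toDual {j | B.E j ⊆ range P.σ^[n]},
      fun m n h j hj => hj.trans (hanti m n h)⟩
  obtain ⟨N, hN⟩ := WellFoundedGT.monotone_chain_condition J
  have hJ : {j | B.E j ⊆ range P.σ^[N]} = {j | B.E j ⊆ range P.σ^[N + 1]} :=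
    OrderDual.toDual.injective (hN (N + 1) N.le_succ)
  refine ⟨N, fun p hp => ?_⟩
  obtain ⟨j, hj⟩ := B.exists_mem_E p
  have h : j ∈ {j | B.E j ⊆ range P.σ^[N]} := B.isSaturated_range_iterate N j p hj hp
  rw [hJ] at h
  rw [← range_comp, ← Function.iterate_succ']
  exact h hj

/-- For each `E_j ⊆ Y` choose `E_i ⊆ Y` with `σ(E_i) ⊇ E_j`, and transplant the values of `f` on
`E_j` to `E_i ∩ σ⁻¹(E_j)`. Since `σ` is injective on `E_i`, each point of `E_j` then has exactly one
preimage in the chosen set `W`. -/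
theorem exists_transfer_eq {Y : Set P.X} (hY : B.IsSaturated Y) (hσY : Y ⊆ P.σ '' Y)
    (f : C(P.X, ℤ)) (hf : ∀ p ∉ Y, f p = 0) :
    ∃ g : C(P.X, ℤ), (∀ p ∉ Y, g p = 0) ∧ transfer P.isPiecewiseHomeo g = f ∧
      (0 ≤ f → 0 ≤ g) := by
  classical
  have hex : ∀ j, ∃ i, B.E j ⊆ Y → B.E i ⊆ Y ∧ B.E j ⊆ P.σ '' B.E i := by
    intro j
    by_cases h : B.E j ⊆ Y
    · obtain ⟨r, hr⟩ := B.E_nonempty j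
      obtain ⟨p, hp, rfl⟩ := hσY (h hr)
      obtain ⟨i, hi⟩ := B.exists_mem_E p
      exact ⟨i, fun _ => ⟨hY i p hi hp, B.E_subset_image_σ hi hr⟩⟩
    · exact ⟨j, fun h' => absurd h' h⟩
  choose i hi using hex
  set W : Set P.X := ⋃ j ∈ {j | B.E j ⊆ Y}, (B.E (i j) ∩ P.σ ⁻¹' B.E j) with hWdef
  have hW : IsClopen W := (toFinite {j | B.E j ⊆ Y}).isClopen_biUnion fun j _ =>
    (B.isClopen_E _).inter ((B.isClopen_E _).preimage P.isPiecewiseHomeo.continuous)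
  have hWm : ∀ p, p ∈ W ↔ ∃ j, B.E j ⊆ Y ∧ p ∈ B.E (i j) ∧ P.σ p ∈ B.E j := by
    intro p
    simp [hWdef, and_left_comm]
  let g : C(P.X, ℤ) := ⟨W.indicator (f ∘ P.σ),
    hW.continuous_indicator (f.continuous.comp P.isPiecewiseHomeo.continuous)⟩
  have hg : ∀ p ∈ W, g p = f (P.σ p) := fun p hp => indicator_of_mem hp _
  have hg' : ∀ p ∉ W, g p = 0 := fun p hp => indicator_of_notMem hp _
  refine ⟨g, fun p hp => hg' p fun hpW => ?_, B.ext_E fun j r hr => ?_, fun h p => ?_⟩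
  · obtain ⟨j, hj, hpj, -⟩ := (hWm p).1 hpW
    exact hp ((hi j hj).1 hpj)
  · have h0 : ¬ B.E j ⊆ Y → f r = 0 := fun h => hf r fun hrY => h (hY j r hr hrY)
    -- Only the chosen index `i j` contributes. If `E_j` is not contained in `Y`, the index is
    -- arbitrary, but then `f r = 0`.
    refine (B.transferFun_eq g hr (fun k => if k = i j then f r else 0) ?_).trans ?_
    · rintro k p hp rfl
      by_cases hpW : p ∈ W
      · obtain ⟨j', hj', hpj', hσp⟩ := (hWm p).1 hpW
        obtain rfl := B.E_unique hr hσp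
        rw [hg p hpW, if_pos (B.E_unique hp hpj')]
      · rw [hg' p hpW]
        split_ifs with hk
        · refine (h0 fun hj => hpW ((hWm p).2 ⟨j, hj, hk ▸ hp, hr⟩)).symm
        · rfl
    · simp only [ite_mul, zero_mul, Finset.sum_ite_eq', Finset.mem_univ, if_true]
      by_cases hj : B.E j ⊆ Y
      · simp [A, (hi j hj).2]
      · rw [h0 hj, zero_mul]
  · exact indicator_nonneg (fun q _ => h (P.σ q)) p

/-- The image of a sufficiently high power of the transfer map is contained in the images of all
powers. -/
theorem exists_transfer_iterate_eq (B : MarkovPartition P) : ∃ N, ∀ (n : ℕ) (f : C(P.X, ℤ)), ∃ g : C(P.X, ℤ),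
    (transfer P.isPiecewiseHomeo)^[n] g = (transfer P.isPiecewiseHomeo)^[N] f ∧
      (0 ≤ f → 0 ≤ g) := by
  obtain ⟨N, hN⟩ := B.exists_range_iterate_subset
  have key : ∀ (n : ℕ) (f : C(P.X, ℤ)), (∀ p ∉ range P.σ^[N], f p = 0) →
      ∃ g : C(P.X, ℤ), (∀ p ∉ range P.σ^[N], g p = 0) ∧
        (transfer P.isPiecewiseHomeo)^[n] g = f ∧ (0 ≤ f → 0 ≤ g) := by
    intro n
    induction n with
    | zero => exact fun f hf => ⟨f, hf, rfl, id⟩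
    | succ n ih =>
      intro f hf
      obtain ⟨g, hg, hgf, hpos⟩ := ih f hf
      obtain ⟨g', hg', hgf', hpos'⟩ :=
        B.exists_transfer_eq (B.isSaturated_range_iterate N) hN g hg
      exact ⟨g', hg', by rw [Function.iterate_succ_apply, hgf', hgf], hpos' ∘ hpos⟩
  refine ⟨N, fun n f => ?_⟩
  obtain ⟨g, -, hgf, hpos⟩ := key n ((transfer P.isPiecewiseHomeo)^[N] f)
    fun p hp => transfer_iterate_apply_eq_zero _ f N hp
  exact ⟨g, hgf, fun hf => hpos (transfer_iterate_nonneg _ hf N)⟩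

/-- Every element of `DG(τ)` has a preimage under each power of `𝓛_*`, positive if it is positive. -/
theorem exists_Lstar_iterate_eq (B : MarkovPartition P) (n : ℕ) (f : C(P.X, ℤ)) :
    ∃ g : C(P.X, ℤ), P.Lstar^[n] (P.cls g) = P.cls f ∧ (0 ≤ f → 0 ≤ g) := by
  obtain ⟨N, hN⟩ := B.exists_transfer_iterate_eq
  -- Taking `N + n` transfers of `g` gives `𝓛ᴺ(𝓛ⁿ g) = 𝓛ᴺ f`, which is precisely the congruence of
  -- `𝓛ⁿ g` and `f`.
  obtain ⟨g, hg, hpos⟩ := hN (N + n) f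
  refine ⟨g, ?_, hpos⟩
  rw [DimGroup.endo_iterate_mk, DimGroup.mk_eq_mk]
  exact ⟨N, by rw [← Function.iterate_add_apply, hg]⟩

theorem bijective_Lstar (B : MarkovPartition P) : Function.Bijective P.Lstar := by
  refine ⟨DimGroup.endo_injective _, fun x => ?_⟩
  obtain ⟨f, rfl⟩ := DimGroup.mk_surjective _ x
  obtain ⟨g, hg, -⟩ := B.exists_Lstar_iterate_eq 1 f
  exact ⟨_, hg⟩

/-! ### The isomorphism from `G_A` onto `DG(τ)`. -/

theorem transfer_iterate_ψ (v : Fin B.q → ℤ) (n : ℕ) :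
    (transfer P.isPiecewiseHomeo)^[n] (B.ψ v) = B.ψ (Matrix.vecMul v (B.A ^ n)) := by
  induction n with
  | zero => simp
  | succ n ih =>
    rw [Function.iterate_succ_apply', ih, transfer_ψ, Matrix.vecMul_vecMul, pow_succ]

theorem ψ_add (v w : Fin B.q → ℤ) : B.ψ (v + w) = B.ψ v + B.ψ w := by
  simp only [ψ, Pi.add_apply, add_smul, Finset.sum_add_distrib]

/-- `𝓛_*` as an automorphism of `DG(τ)`. -/
noncomputable def LstarEquiv : P.DG ≃+ P.DG := AddEquiv.ofBijective P.Lstar B.bijective_Lstar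

theorem LstarEquiv_symm_iterate_eq_iff {n : ℕ} {x y : P.DG} :
    B.LstarEquiv.symm^[n] x = y ↔ x = P.Lstar^[n] y := by
  have h1 : Function.LeftInverse B.LstarEquiv.symm^[n] P.Lstar^[n] :=
    Function.LeftInverse.iterate B.LstarEquiv.symm_apply_apply n
  have h2 : Function.LeftInverse P.Lstar^[n] B.LstarEquiv.symm^[n] :=
    Function.LeftInverse.iterate B.LstarEquiv.apply_symm_apply n
  exact ⟨fun h => h ▸ (h2 x).symm, fun h => h ▸ h1 y⟩

/-- The map `v ↦ 𝓛_*⁻ⁿ [ψ v]`. -/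
noncomputable def stageHom (n : ℕ) : (Fin B.q → ℤ) →ₗ[ℤ] P.DG :=
  (AddMonoidHom.mk' (fun v => B.LstarEquiv.symm^[n] (P.cls (B.ψ v))) fun v w => by
    rw [B.ψ_add, MonotonePartition.cls, map_add, iterate_map_add]).toIntLinearMap

theorem stageHom_eq_iff {n : ℕ} {v : Fin B.q → ℤ} {x : P.DG} :
    B.stageHom n v = x ↔ P.cls (B.ψ v) = P.Lstar^[n] x :=
  B.LstarEquiv_symm_iterate_eq_iff

theorem stageHom_compat (i j : ℕ) (h : i ≤ j) (v : Fin B.q → ℤ) :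
    B.stageHom j ((B.A ^ (j - i)).vecMulLinear v) = B.stageHom i v := by
  have h1 : P.cls (B.ψ v) = P.Lstar^[i] (B.stageHom i v) := B.stageHom_eq_iff.1 rfl
  have h2 : P.Lstar^[j] (B.stageHom i v) = P.Lstar^[j - i] (P.Lstar^[i] (B.stageHom i v)) := by
    rw [← Function.iterate_add_apply, Nat.sub_add_cancel h]
  rw [stageHom_eq_iff, Matrix.vecMulLinear_apply, ← B.transfer_iterate_ψ, h2, ← h1,
    DimGroup.endo_iterate_mk]

/-- The homomorphism `[v, n] ↦ 𝓛_*⁻ⁿ [ψ v]`. -/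
noncomputable def limitHom : MatrixGroup B.A →ₗ[ℤ] P.DG :=
  Module.DirectLimit.lift ℤ ℕ _ _ B.stageHom B.stageHom_compat

theorem limitHom_mk (v : Fin B.q → ℤ) (n : ℕ) :
    B.limitHom (MatrixGroup.mk B.A v n) = B.stageHom n v :=
  Module.DirectLimit.lift_of B.stageHom B.stageHom_compat v

theorem exists_limitHom_mk_eq (f : C(P.X, ℤ)) :
    ∃ v n, B.limitHom (MatrixGroup.mk B.A v n) = P.cls f ∧ (0 ≤ f → 0 ≤ v) := by
  obtain ⟨n, v, h⟩ := B.exists_transfer_iterate_eq_ψ f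
  refine ⟨v, n, ?_, fun hf => B.ψ_nonneg_iff.1 (h ▸ transfer_iterate_nonneg _ hf n)⟩
  rw [limitHom_mk, stageHom_eq_iff, DimGroup.endo_iterate_mk, h]

theorem exists_matrixGroup_mk (x : MatrixGroup B.A) : ∃ v n, MatrixGroup.mk B.A v n = x := by
  obtain ⟨n, v, h⟩ := Module.DirectLimit.exists_of x
  exact ⟨v, n, h⟩

/-- If `[v, n]` maps to zero, then `𝓛ᵐ (ψ v) = ψ (v Aᵐ)` vanishes for some `m`. Hence `v Aᵐ = 0`,
and `[v, n]` already vanishes at stage `n + m`. -/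
theorem limitHom_injective : Function.Injective B.limitHom := by
  rw [injective_iff_map_eq_zero]
  intro x hx
  obtain ⟨v, n, rfl⟩ := B.exists_matrixGroup_mk x
  rw [limitHom_mk, stageHom_eq_iff, iterate_map_zero,
    ← map_zero (DimGroup.mk P.isPiecewiseHomeo), DimGroup.mk_eq_mk] at hx
  obtain ⟨m, hm⟩ := hx
  rw [transfer_iterate_ψ, iterate_map_zero] at hm
  have hv : Matrix.vecMul v (B.A ^ m) = 0 := B.ψ_injective (hm.trans (by simp [ψ]))
  have h : MatrixGroup.mk B.A ((B.A ^ (n + m - n)).vecMulLinear v) (n + m) =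
      MatrixGroup.mk B.A v n := Module.DirectLimit.of_f (hij := Nat.le_add_right n m)
  rw [← h, Matrix.vecMulLinear_apply, Nat.add_sub_cancel_left, hv]
  exact map_zero _

theorem limitHom_bijective : Function.Bijective B.limitHom := by
  refine ⟨B.limitHom_injective, fun y => ?_⟩
  obtain ⟨f, rfl⟩ := DimGroup.mk_surjective _ y
  obtain ⟨v, n, h, -⟩ := B.exists_limitHom_mk_eq f
  exact ⟨_, h⟩

theorem limitHom_image_pos : B.limitHom '' MatrixGroup.pos B.A = P.DGpos := by
  ext y
  constructor
  · rintro ⟨_, ⟨v, n, hv, rfl⟩, rfl⟩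
    -- Here positivity of preimages is needed: `𝓛_*⁻ⁿ [ψ v]` must be represented by a nonnegative
    -- function.
    obtain ⟨g, hg, hpos⟩ := B.exists_Lstar_iterate_eq n (B.ψ v)
    refine ⟨g, hpos (B.ψ_nonneg_iff.2 hv), ?_⟩
    rw [limitHom_mk, eq_comm, stageHom_eq_iff, hg]
  · rintro ⟨f, hf, rfl⟩
    obtain ⟨v, n, h, hv⟩ := B.exists_limitHom_mk_eq f
    exact ⟨_, ⟨v, n, hv hf, rfl⟩, h⟩

theorem limitHom_endo (x : MatrixGroup B.A) :
    B.limitHom (MatrixGroup.endo B.A x) = P.Lstar (B.limitHom x) := by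
  obtain ⟨v, n, rfl⟩ := B.exists_matrixGroup_mk x
  rw [MatrixGroup.endo_mk, limitHom_mk, limitHom_mk, stageHom_eq_iff, ← B.transfer_ψ,
    MonotonePartition.cls, ← DimGroup.endo_mk, ← Function.iterate_succ_apply, Function.iterate_succ_apply',
    ← B.stageHom_eq_iff.1 rfl]

end MarkovPartition

end IntervalDim

theorem proposition1p82 (τ : unitInterval → unitInterval)
    (P : IntervalDim.MonotonePartition τ) (B : IntervalDim.MarkovPartition P) :
    ∃ (hL : Function.Bijective P.Lstar) (Φ : IntervalDim.MatrixGroup B.A ≃+ P.DG),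
      (∀ (v : Fin B.q → ℤ) (n : ℕ),
        Φ (IntervalDim.MatrixGroup.mk B.A v n) =
          (AddEquiv.ofBijective P.Lstar hL).symm^[n] (P.cls (B.ψ v))) ∧
      IntervalDim.IsTripleIso
        (IntervalDim.MatrixGroup.pos B.A) (IntervalDim.MatrixGroup.endo B.A)
        P.DGpos P.Lstar Φ :=
  ⟨B.bijective_Lstar,
    AddEquiv.ofBijective B.limitHom.toAddMonoidHom B.limitHom_bijective,
    B.limitHom_mk, B.limitHom_image_pos, B.limitHom_endo⟩
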